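/- Conventions. For $i=1,2$ let $L_i$ be a dense chain (linearly ordered set) with more than one element and without endpoints, and let $G_i$ be a subgroup of the group $\mathrm{Aut}(L_i)$ of order automorphisms of $L_i$. Let $\bar L_i$ be the Dedekind completion of $L_i$ without added endpoints, with its order topology; each $g\in\mathrm{Aut}(L_i)$ extends uniquely to an automorphism of $\bar L_i$, also denoted $g$. An interval of a chain $L$ is a set of one of the forms $(x,y)$ with $x<y$ in $L$, $(-\infty,x)$, $(x,\infty)$, or $L$. We write $I<J$ for nonempty $I,J\subseteq L$ if $x<y$ for all $x\in I$, $y\in J$. The group $G\le\mathrm{Aut}(L)$ is 2-interval-transitive if for all intervals $I_1<I_2$ and $J_1<J_2$ of $L$ there is $g\in G$ with $g(I_1)\cap J_1\neq\emptyset$ and $g(I_2)\cap J_2\neq\emptyset$. The support of $g$ is $\mathrm{supp}(g)=\{x\in\bar L: g(x)\ne x\}$; $g$ is bounded if $\mathrm{supp}(g)\subseteq(a,b)$ for some $a<b$ in $\bar L$. Put $\mathrm{var}(g)=\mathrm{int}(\mathrm{cl}(\mathrm{supp}(g)))$ in $\bar L$, and let $\mathrm{Ep}(L,G)\subseteq\bar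 L$ be the set of all endpoints in $\bar L$ (infimum and supremum, where they exist) of the convex hulls of the nonempty sets $\mathrm{var}(g)$, $g\in G$; it is $G$-invariant. For a chain $X$ the equal direction relation is $$\mathrm{Ed}(x_1,x_2,y_1,y_2)\iff (x_1<x_2\wedge y_1<y_2)\vee(x_1>x_2\wedge y_1>y_2),$$ and $X^{\mathrm{rel}}=\langle X,\mathrm{Ed}\rangle$. Let $\mathrm{EP}(L,G)=\langle \mathrm{Ep}(L,G),\mathrm{Ed}\rangle$ with $\mathrm{Ed}$ restricted from $\bar L$. If $G$ acts on $M=\langle X,\mathrm{Ed}\rangle$, let $\mathrm{ACT}(M,G)$ be the first-order structure whose universe is the disjoint union of $X$ and $G$, with predicates for $X$ and for $G$, the relation $\mathrm{Ed}$ on $X$, the (partial) group operation on $G$, and the (partial) application function $(g,x)\mapsto g(x)$ for $g\in G$, $x\in X$. (A partial operation is encoded by a predicate for its domain and the total operation which takes its first argument as value outside the domain.) The symbol $\equiv$ denotes elementary equivalence; for groups, in the language of groups. A bijection of chains is monotonic if it preserves or reverses order. Theorem (Linear Reconstruction Theorem). Assume that for $i=1,2$ the group $G_i\le\mathrm{Aut}(L_i)$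 is 2-interval-transitive and contains a nonidentity bounded element. (1) If $G_1\equiv G_2$, then $\mathrm{ACT}(\mathrm{EP}(L_1,G_1),G_1)\equiv\mathrm{ACT}(\mathrm{EP}(L_2,G_2),G_2)$. (2) Let $\alpha:G_1\to G_2$ be a group isomorphism. Then there is a unique monotonic bijection $\tau:\bar L_1\to\bar L_2$ such that $\alpha(g)=\tau\circ g\circ\tau^{-1}$ for all $g\in G_1$; or, put another way, there is a unique isomorphism $\tau:\bar L_1^{\mathrm{rel}}\to\bar L_2^{\mathrm{rel}}$ such that $\tau\cup\alpha$ is an isomorphism from $\mathrm{ACT}(\bar L_1^{\mathrm{rel}},G_1)$ to $\mathrm{ACT}(\bar L_2^{\mathrm{rel}},G_2)$. -/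

import Mathlib

/-- The Dedekind completion of a chain, without added endpoints: the Dedekind-MacNeille completion
with its least and its greatest element removed. -/
def DedekindCompletion (L : Type*) [LinearOrder L] : Type _ :=
  {A : DedekindCut L // A ≠ ⊥ ∧ A ≠ ⊤}

namespace DedekindCompletion

noncomputable instance (L : Type*) [LinearOrder L] : LinearOrder (DedekindCompletion L) :=
  inferInstanceAs (LinearOrder {A : DedekindCut L // A ≠ ⊥ ∧ A ≠ ⊤})

/-- The order topology, generated by the open rays. -/
noncomputable instance (L : Type*) [LinearOrder L] : TopologicalSpace (DedekindCompletion L) :=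
  Preorder.topology _

instance (L : Type*) [LinearOrder L] : OrderTopology (DedekindCompletion L) := ⟨rfl⟩

/-- The image of a Dedekind cut under an automorphism of the chain. -/
def mapCut {L : Type*} [LinearOrder L] (g : L ≃o L) (A : DedekindCut L) : DedekindCut L where
  extent := g '' A.left
  intent := g '' A.right
  upperPolar_extent := by
    change upperBounds (g '' A.left) = g '' A.right
    rw [OrderIso.upperBounds_image, DedekindCut.upperBounds_left]
  lowerPolar_intent := by
    change lowerBounds (g '' A.right) = g '' A.left
    rw [OrderIso.lowerBounds_image, DedekindCut.lowerBounds_right]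

theorem mapCut_one {L : Type*} [LinearOrder L] (A : DedekindCut L) :
    mapCut (1 : L ≃o L) A = A :=
  DedekindCut.ext (Set.image_id _)

theorem mapCut_mul {L : Type*} [LinearOrder L] (g h : L ≃o L) (A : DedekindCut L) :
    mapCut (g * h) A = mapCut g (mapCut h A) :=
  DedekindCut.ext (Set.image_comp g h _)

theorem mapCut_mono {L : Type*} [LinearOrder L] (g : L ≃o L) {A B : DedekindCut L} (h : A ≤ B) :
    mapCut g A ≤ mapCut g B :=
  Concept.extent_subset_extent_iff.1 (Set.image_mono (Concept.extent_subset_extent_iff.2 h))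

/-- An automorphism of the chain as an automorphism of the lattice of all its cuts. -/
def cutIso {L : Type*} [LinearOrder L] (g : L ≃o L) : DedekindCut L ≃o DedekindCut L where
  toFun := mapCut g
  invFun := mapCut g⁻¹
  left_inv A := by rw [← mapCut_mul, inv_mul_cancel, mapCut_one]
  right_inv A := by rw [← mapCut_mul, mul_inv_cancel, mapCut_one]
  map_rel_iff' {A B} := by
    refine ⟨fun h => ?_, mapCut_mono g⟩
    have := mapCut_mono g⁻¹ h
    change mapCut g⁻¹ (mapCut g A) ≤ mapCut g⁻¹ (mapCut g B) at this
    rwa [← mapCut_mul, ← mapCut_mul, inv_mul_cancel, mapCut_one, mapCut_one] at this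

/-- Automorphisms of a chain act on its Dedekind completion: `g • A` is the cut `g(A)`, so that
`A ↦ g • A` is the extension of `g` to the completion. -/
instance (L : Type*) [LinearOrder L] : MulAction (L ≃o L) (DedekindCompletion L) where
  smul g A := ⟨mapCut g A.1,
    fun h => A.2.1 ((map_eq_bot_iff (cutIso g)).1 h), fun h => A.2.2 ((map_eq_top_iff (cutIso g)).1 h)⟩
  one_smul A := Subtype.ext (mapCut_one A.1)
  mul_smul g h A := Subtype.ext (mapCut_mul g h A.1)

/-- The extension of an automorphism to the completion, as an order automorphism. -/
def extend {L : Type*} [LinearOrder L] (g : L ≃o L) :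
    DedekindCompletion L ≃o DedekindCompletion L where
  toEquiv := MulAction.toPerm g
  map_rel_iff' {A B} := (cutIso g).le_iff_le (x := A.1) (y := B.1)

end DedekindCompletion

namespace LinearPermGroup

/-- The intervals of a chain: open, nonempty, bounded or not, with endpoints in the chain. -/
def IsInterval {L : Type*} [LinearOrder L] (I : Set L) : Prop :=
  (∃ x y, x < y ∧ I = Set.Ioo x y) ∨ (∃ x, I = Set.Iio x) ∨ (∃ x, I = Set.Ioi x) ∨ I = Set.univ

/-- `I 0 < ... < I (n - 1)`. -/
def Increasing {L : Type*} [LinearOrder L] {n : ℕ} (I : Fin n → Set L) : Prop :=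
  (∀ i, (I i).Nonempty) ∧ ∀ x : Fin n → L, (∀ i, x i ∈ I i) → StrictMono x

def IntervalTransitive {L : Type*} [LinearOrder L] (n : ℕ) (G : Subgroup (L ≃o L)) : Prop :=
  ∀ I J : Fin n → Set L, (∀ i, IsInterval (I i)) → (∀ i, IsInterval (J i)) →
    Increasing I → Increasing J → ∃ g ∈ G, ∀ i, ((g '' I i) ∩ J i).Nonempty

/-- The support of `g`, a subset of the Dedekind completion. -/
def supp {L : Type*} [LinearOrder L] (g : L ≃o L) : Set (DedekindCompletion L) :=
  {x | g • x ≠ x}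

/-- `g` is bounded: its support lies in a bounded interval of the Dedekind completion. -/
def IsBoundedElement {L : Type*} [LinearOrder L] (g : L ≃o L) : Prop :=
  ∃ a b : DedekindCompletion L, a < b ∧ supp g ⊆ Set.Ioo a b

/-- The regular open set `int (cl (supp g))`. -/
def var {L : Type*} [LinearOrder L] (g : L ≃o L) : Set (DedekindCompletion L) :=
  interior (closure (supp g))

/-- The convex hull of a subset of a chain. -/
def hull {X : Type*} [LinearOrder X] (U : Set X) : Set X :=
  {z | ∃ x ∈ U, ∃ y ∈ U, x ≤ z ∧ z ≤ y}

/-- The endpoints, where they exist, of the convex hull of `U`. -/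
def endpoints {X : Type*} [LinearOrder X] (U : Set X) : Set X :=
  {x | (hull U).Nonempty ∧ (IsGLB (hull U) x ∨ IsLUB (hull U) x)}

/-- `Ep(L, G)`: all endpoints in the completion of the sets `var g` with `g ∈ G`. -/
def Ep {L : Type*} [LinearOrder L] (G : Subgroup (L ≃o L)) : Set (DedekindCompletion L) :=
  {x | ∃ g ∈ G, x ∈ endpoints (var g)}

theorem smul_mem_endpoints {X : Type*} [LinearOrder X] (e : X ≃o X) {U : Set X} {x : X}
    (hx : x ∈ endpoints U) : e x ∈ endpoints (e '' U) := by
  have hh : hull (e '' U) = e '' hull U := by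
    ext z
    constructor
    · rintro ⟨_, ⟨x, hx, rfl⟩, _, ⟨y, hy, rfl⟩, h1, h2⟩
      exact ⟨e.symm z, ⟨x, hx, y, hy, e.le_symm_apply.2 h1, e.symm_apply_le.2 h2⟩, by simp⟩
    · rintro ⟨w, ⟨x, hx, y, hy, h1, h2⟩, rfl⟩
      exact ⟨e x, ⟨x, hx, rfl⟩, e y, ⟨y, hy, rfl⟩, e.monotone h1, e.monotone h2⟩
  obtain ⟨hne, h⟩ := hx
  refine ⟨hh ▸ hne.image e, ?_⟩
  rw [hh]
  exact h.imp (OrderIso.isGLB_image' e).2 (OrderIso.isLUB_image' e).2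

theorem var_conj {L : Type*} [LinearOrder L] (g h : L ≃o L) :
    var (h * g * h⁻¹) = DedekindCompletion.extend h '' var g := by
  have hs : supp (h * g * h⁻¹) = DedekindCompletion.extend h '' supp g := by
    ext x
    constructor
    · intro hx
      refine ⟨h⁻¹ • x, fun hg => hx ?_, smul_inv_smul h x⟩
      rw [mul_smul, mul_smul, hg, smul_inv_smul]
    · rintro ⟨y, hy, rfl⟩ hx
      apply hy
      change (h * g * h⁻¹) • h • y = h • y at hx
      rw [mul_smul, inv_smul_smul, mul_smul] at hx
      exact (MulAction.injective h) hx
  have hi := (DedekindCompletion.extend h).toHomeomorph.image_interior (closure (supp g))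
  have hc := (DedekindCompletion.extend h).toHomeomorph.image_closure (supp g)
  simp only [OrderIso.coe_toHomeomorph] at hi hc
  rw [var, var, hs, hi, hc]

/-- `G` acts on `Ep(L, G)` by restriction of its action on the completion. -/
instance {L : Type*} [LinearOrder L] (G : Subgroup (L ≃o L)) : MulAction G (Ep G) where
  smul h x := ⟨(h : L ≃o L) • (x : DedekindCompletion L), by
    obtain ⟨g, hg, hx⟩ := x.2
    refine ⟨h.1 * g * h.1⁻¹, G.mul_mem (G.mul_mem h.2 hg) (G.inv_mem h.2), ?_⟩
    rw [var_conj]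
    exact smul_mem_endpoints (DedekindCompletion.extend h.1) hx⟩
  one_smul x := Subtype.ext (one_smul _ _)
  mul_smul g h x := Subtype.ext (mul_smul _ _ _)

/-- The equal direction relation of a chain. -/
def Ed {X : Type*} [LinearOrder X] (x₁ x₂ y₁ y₂ : X) : Prop :=
  (x₁ < x₂ ∧ y₁ < y₂) ∨ (x₁ > x₂ ∧ y₁ > y₂)

inductive GroupFunc : ℕ → Type
  | mul : GroupFunc 2

/-- The language of groups. -/
def groupLang : FirstOrder.Language := ⟨GroupFunc, fun _ => Empty⟩

/-- Every group is a structure for the language of groups. -/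
instance (G : Type*) [Group G] : groupLang.Structure G where
  funMap | .mul => fun v => v 0 * v 1
  RelMap r := r.elim

inductive ActFunc : ℕ → Type
  | mul : ActFunc 2
  | ap : ActFunc 2

inductive ActRel : ℕ → Type
  | ed : ActRel 4
  | isPoint : ActRel 1
  | isGroup : ActRel 1
  | mulDom : ActRel 2
  | apDom : ActRel 2

/-- The language of group actions on equal direction structures: the equal direction relation on
points, the group operation, the application of group elements to points, and predicates for the
two sorts. The two operations are partial, so each comes with a predicate for its domain. -/
def actLang : FirstOrder.Language := ⟨ActFunc, ActRel⟩

/-- The universe of the structure `ACT(X, G)`: the disjoint union of the points and the group. -/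
inductive ACT (X G : Type*)
  | point : X → ACT X G
  | elt : G → ACT X G

namespace ACT

/-- Group multiplication; the value outside its domain is the first argument. -/
def mul {X G : Type*} [Group G] : ACT X G → ACT X G → ACT X G
  | .elt g, .elt h => .elt (g * h)
  | a, _ => a

/-- Application of a group element to a point; the value outside its domain is the first
argument. -/
def ap {X G : Type*} [Group G] [MulAction G X] : ACT X G → ACT X G → ACT X G
  | .elt g, .point x => .point (g • x)
  | a, _ => a

def IsPoint {X G : Type*} (a : ACT X G) : Prop := ∃ x : X, a = .point x

def IsGroup {X G : Type*} (a : ACT X G) : Prop := ∃ g : G, a = .elt g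

/-- The structure `ACT(X, G)` for a group `G` acting on the equal direction structure of the
chain `X`. -/
instance (X G : Type*) [LinearOrder X] [Group G] [MulAction G X] :
    actLang.Structure (ACT X G) where
  funMap
    | .mul => fun v => mul (v 0) (v 1)
    | .ap => fun v => ap (v 0) (v 1)
  RelMap
    | .ed => fun v => ∃ x₁ x₂ y₁ y₂ : X, v 0 = .point x₁ ∧ v 1 = .point x₂ ∧ v 2 = .point y₁ ∧
        v 3 = .point y₂ ∧ Ed x₁ x₂ y₁ y₂
    | .isPoint => fun v => IsPoint (v 0)
    | .isGroup => fun v => IsGroup (v 0)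
    | .mulDom => fun v => IsGroup (v 0) ∧ IsGroup (v 1)
    | .apDom => fun v => IsGroup (v 0) ∧ IsPoint (v 1)

end ACT

end LinearPermGroup

/-! ### Disjointness, separation and direction of supports in the language of groups. -/

namespace LinearPermGroup

open scoped commutatorElement

/-! The group sees the chain through supports. The action on the completion is locally moving: every
interval contains the support of a nontrivial element (`chainAction`). For such actions a formula in
the group operation alone says that two supports are disjoint (`disj_of_disjoint`,
`not_disj_of_ne`). Together with 2-interval-transitivity this expresses that one support lies
entirely to one side of another (`sep_iff`), and that two such pairs point the same way (`dir_iff`):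
an order-preserving map cannot carry a pair of supports onto one that lies the other way round, and
transitivity supplies a map when the directions agree. The orientation of the chain stays invisible,
but one separated pair `p`, `q`, used as a compass, makes the order of supports definable.

For elementary equivalence, the points of `Ep` are the suprema and infima of supports. A triple `(g,
p, q)` names one of them: the pair `p`, `q` chooses the end of the support of `g`. Naming a point,
equality, equal direction and the action are all formulas about triples. A triple that names no
point stands for its first entry, so triples cover the whole structure, and the same formulas
interpret it in both groups (`jointInterp_denote`); a sentence about the actions is thereby
translated into a sentence about the groups.

For an isomorphism `α`, the formulas are preserved, so `α` preserves or reverses the order of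
supports; in the second case the second chain is turned around. A point is determined by the
elements supported below it. It is sent to the supremum of the supports of their images
(`exists_matches`), and the symmetric construction for `α⁻¹` gives surjectivity. Uniqueness holds
because a monotonic bijection commuting with the action maps every support onto itself, which local
movement forbids unless it is the identity (`eq_self_of_commute`). -/

/-- A faithful action of a group on a chain by automorphisms which is locally moving and
2-interval-transitive. -/
structure ChainAction (X G : Type*) [LinearOrder X] [Group G] [MulAction G X] : Prop where
  smul_lt : ∀ (g : G) {x y : X}, x < y → g • x < g • y
  eq_one : ∀ g : G, (∀ x : X, g • x = x) → g = 1
  moving : ∀ {a b : X}, a < b → ∃ g : G, g ≠ 1 ∧ ∀ x : X, g • x ≠ x → a < x ∧ x < b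
  trans : ∀ {a b c d a' b' c' d' : X}, a < b → b ≤ c → c < d → a' < b' → b' ≤ c' → c' < d' →
    ∃ (g : G) (x y : X), (a < x ∧ x < b) ∧ (c < y ∧ y < d) ∧
      (a' < g • x ∧ g • x < b') ∧ (c' < g • y ∧ g • y < d')

/-- The first-order rendering of disjointness of supports. -/
def Disj {G : Type*} [Group G] (f g : G) : Prop :=
  ∀ h, ¬ f * h = h * f → ∃ f₁ f₂, f₁ * g = g * f₁ ∧ f₂ * g = g * f₂ ∧
    ⁅f₁, ⁅f₂, h⁆⁆ ≠ 1 ∧ ⁅f₁, ⁅f₂, h⁆⁆ * g = g * ⁅f₁, ⁅f₂, h⁆⁆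

/-- The first-order rendering of disjointness of the convex hulls of two nonempty supports. -/
def Sep {G : Type*} [Group G] (f g : G) : Prop :=
  f ≠ 1 ∧ g ≠ 1 ∧ ¬ ∃ h, ¬ Disj (h * f * h⁻¹) g ∧ ¬ Disj (h * g * h⁻¹) f

/-- The first-order rendering of the equal direction relation for supports. -/
def Dir {G : Type*} [Group G] (f₁ f₂ g₁ g₂ : G) : Prop :=
  Sep f₁ f₂ ∧ Sep g₁ g₂ ∧ ∃ h, ¬ Disj (h * f₁ * h⁻¹) g₁ ∧ ¬ Disj (h * f₂ * h⁻¹) g₂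

/-- The elements `f` and `g` are nontrivial, and the support of `f` precedes that of `g`. -/
def Before (X : Type*) {G : Type*} [LinearOrder X] [Group G] [MulAction G X] (f g : G) : Prop :=
  f ≠ 1 ∧ g ≠ 1 ∧ ∀ x y : X, f • x ≠ x → g • y ≠ y → x < y

namespace ChainAction

variable {X G : Type*} [LinearOrder X] [Group G] [MulAction G X]

theorem dual (h : ChainAction X G) : ChainAction Xᵒᵈ G where
  smul_lt g _ _ hxy := h.smul_lt g hxy
  eq_one g hg := h.eq_one g hg
  moving {a b} hab := by
    obtain ⟨g, h1, h2⟩ := h.moving (a := OrderDual.ofDual b) (b := OrderDual.ofDual a) hab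
    exact ⟨g, h1, fun x hx => (h2 x hx).symm⟩
  trans h1 h2 h3 h4 h5 h6 := by
    obtain ⟨g, x, y, a1, a2, a3, a4⟩ := h.trans h3 h2 h1 h6 h5 h4
    exact ⟨g, y, x, a2.symm, a1.symm, a4.symm, a3.symm⟩

theorem smul_lt_iff (h : ChainAction X G) (g : G) {x y : X} : g • x < g • y ↔ x < y :=
  ⟨fun hxy => by simpa using h.smul_lt g⁻¹ hxy, h.smul_lt g⟩

theorem exists_ne (h : ChainAction X G) {g : G} (hg : g ≠ 1) : ∃ x : X, g • x ≠ x := by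
  by_contra! hx
  exact hg (h.eq_one g hx)

/-- On a chain, a point pushed up keeps going up. With `x < m < g • x`, everything above `g⁻¹ • m`
is sent above `m` and stays there, so the single window `(g⁻¹ • m, m)` is left by all positive
powers at once. -/
theorem window_of_lt [DenselyOrdered X] (h : ChainAction X G) {g : G} {x : X} (hx : x < g • x) :
    ∃ a b, a < x ∧ x < b ∧ ∀ y, a < y → y < b → ∀ n : ℕ, ¬ (a < g ^ (n + 1) • y ∧
      g ^ (n + 1) • y < b) := by
  obtain ⟨m, h1, h2⟩ := exists_between hx
  have key : ∀ y, g⁻¹ • m < y → m < g • y := fun y hy => by simpa using h.smul_lt g hy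
  refine ⟨g⁻¹ • m, m, by simpa using h.smul_lt g⁻¹ h2, h1, fun y hy hym n hn => ?_⟩
  have : m < g ^ (n + 1) • y := by
    clear hn
    induction n with
    | zero => simpa using key y hy
    | succ n ih =>
      rw [pow_succ', mul_smul]
      refine key _ (lt_trans ?_ ih)
      exact (hy.trans hym)
  exact absurd hn.2 this.not_gt

theorem exists_window [DenselyOrdered X] (h : ChainAction X G) {g : G} {x : X} (hx : g • x ≠ x) :
    ∃ a b, a < x ∧ x < b ∧ ∀ y, a < y → y < b → ∀ n : ℕ, ¬ (a < g ^ (n + 1) • y ∧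
      g ^ (n + 1) • y < b) := by
  rcases lt_or_gt_of_ne hx with hx | hx
  · obtain ⟨a, b, h1, h2, h3⟩ := h.dual.window_of_lt (g := g) (x := OrderDual.toDual x) hx
    exact ⟨b, a, h2, h1, fun y hy hy' n hn => h3 y hy' hy n hn.symm⟩
  · exact h.window_of_lt hx

theorem exists_displaced [DenselyOrdered X] (h : ChainAction X G) {g : G} {x : X}
    (hx : g • x ≠ x) : ∃ a b, a < x ∧ x < b ∧ ∀ y, a < y → y < b → ¬ (a < g • y ∧ g • y < b) := by
  obtain ⟨a, b, h1, h2, h3⟩ := h.exists_window hx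
  exact ⟨a, b, h1, h2, fun y hy hy' => by simpa using h3 y hy hy' 0⟩

theorem exists_Ioo [DenselyOrdered X] (h : ChainAction X G) {g : G} {x : X}
    (hx : g • x ≠ x) : ∃ a b, a < x ∧ x < b ∧ ∀ y, a < y → y < b → g • y ≠ y := by
  obtain ⟨a, b, h1, h2, h3⟩ := h.exists_displaced hx
  exact ⟨a, b, h1, h2, fun y hy hy' he => h3 y hy hy' (by rw [he]; exact ⟨hy, hy'⟩)⟩

theorem eq_of_smul_eq (h : ChainAction X G) {f g : G} (hfg : ∀ x : X, f • x = g • x) : f = g := by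
  rw [← inv_mul_eq_one]
  refine h.eq_one _ fun x => ?_
  rw [mul_smul, ← hfg, inv_smul_smul]

theorem mul_comm_of_disjoint (h : ChainAction X G) {f g : G}
    (hfg : ∀ x : X, f • x = x ∨ g • x = x) : f * g = g * f := by
  have main : ∀ f g : G, (∀ x : X, f • x = x ∨ g • x = x) → ∀ x : X, f • x = x →
      f • g • x = g • f • x := by
    intro f g hfg x hx
    rw [hx]
    rcases hfg (g • x) with h1 | h1
    · exact h1
    · rw [MulAction.injective g h1, hx]
  have hp : ∀ x : X, (f * g) • x = (g * f) • x := by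
    intro x
    rw [mul_smul, mul_smul]
    rcases hfg x with hx | hx
    · exact main f g hfg x hx
    · exact (main g f (fun x => (hfg x).symm) x hx).symm
  exact h.eq_of_smul_eq hp

/-- A `k` that does not commute with `f` moves a point of the support of `f`. Near that point there
is room for `f₁` and `f₂` inside the support of `f`, hence off the support of `g`, and `k` is
displacing enough to drop out of the double commutator, which becomes `⁅f₁, f₂⁆`. -/
theorem disj_of_disjoint [DenselyOrdered X] (h : ChainAction X G) {f g : G}
    (hfg : ∀ x : X, f • x = x ∨ g • x = x) : Disj f g := by
  intro k hk
  obtain ⟨x, hx1, hx2⟩ : ∃ x : X, f • x ≠ x ∧ k • x ≠ x := by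
    by_contra! hc
    exact hk (h.mul_comm_of_disjoint fun x => or_iff_not_imp_left.2 (hc x))
  -- The interval `(u, v)` is moved pointwise by `f`, so `g` fixes it, and `k` throws it off itself.
  obtain ⟨a, b, ha, hb, hab⟩ := h.exists_Ioo hx1
  obtain ⟨a', b', ha', hb', hab'⟩ := h.exists_displaced hx2
  set u := max a a'
  set v := min b b'
  obtain ⟨f₁, hf₁, s₁⟩ := h.moving (a := u) (b := v) (lt_trans (max_lt ha ha') (lt_min hb hb'))
  obtain ⟨y, hy⟩ := h.exists_ne hf₁
  obtain ⟨c, d, hc, hd, hcd⟩ := h.exists_displaced hy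
  -- Supporting `f₂` where `f₁` displaces everything keeps the two from commuting.
  obtain ⟨f₂, hf₂, s₂⟩ := h.moving (a := max u c) (b := min v d)
    (lt_trans (max_lt (s₁ y hy).1 hc) (lt_min (s₁ y hy).2 hd))
  have s₂' : ∀ x : X, f₂ • x ≠ x → u < x ∧ x < v := fun x hx =>
    ⟨(le_max_left _ _).trans_lt (s₂ x hx).1, (s₂ x hx).2.trans_le (min_le_left _ _)⟩
  -- a group element supported in `(u, v)` commutes with `g`
  have comm : ∀ e : G, (∀ x : X, e • x ≠ x → u < x ∧ x < v) → e * g = g * e := by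
    intro e he
    refine h.mul_comm_of_disjoint fun z => or_iff_not_imp_left.2 fun hz => ?_
    exact (hfg z).resolve_left (hab z ((le_max_left _ _).trans_lt (he z hz).1)
      ((he z hz).2.trans_le (min_le_left _ _)))
  have pres : ∀ e : G, (∀ x : X, e • x ≠ x → u < x ∧ x < v) → ∀ z, (u < z ∧ z < v) →
      (u < e • z ∧ e • z < v) := by
    intro e he z hz
    by_cases hez : e • z = z
    · rwa [hez]
    · exact he _ fun hc => hez (MulAction.injective e hc)
  have inv : ∀ e : G, (∀ x : X, e • x ≠ x → u < x ∧ x < v) →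
      ∀ x : X, e⁻¹ • x ≠ x → u < x ∧ x < v := by
    intro e he x hx
    exact he x fun hc => hx (by rw [inv_smul_eq_iff, hc])
  have out : ∀ e : G, (∀ x : X, e • x ≠ x → u < x ∧ x < v) → ∀ x : X, ¬ (u < x ∧ x < v) →
      e • x = x := fun e he x hx => by_contra fun hc => hx (he x hc)
  have hU : ∀ z, (u < z ∧ z < v) → ¬ (u < k⁻¹ • z ∧ k⁻¹ • z < v) := by
    intro z hz hz'
    refine hab' (k⁻¹ • z) ((le_max_right _ _).trans_lt hz'.1)
      (hz'.2.trans_le (min_le_right _ _)) ?_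
    rw [smul_inv_smul]
    exact ⟨(le_max_right _ _).trans_lt hz.1, hz.2.trans_le (min_le_right _ _)⟩
  have kU : ∀ z, (u < z ∧ z < v) → ⁅f₂, k⁆ • z = f₂ • z := by
    intro z hz
    rw [commutatorElement_def, mul_smul, mul_smul, mul_smul, out _ (inv _ s₂') _ (hU z hz),
      smul_inv_smul]
  have kU' : ∀ z, (u < z ∧ z < v) → ⁅f₂, k⁆⁻¹ • z = f₂⁻¹ • z := by
    intro z hz
    rw [inv_smul_eq_iff, kU _ (pres _ (inv _ s₂') z hz), smul_inv_smul]
  -- `⁅f₂, k⁆` is `f₂` times a conjugate of `f₂⁻¹` supported in the image of `(u, v)` under `k`.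
  -- That image misses `(u, v)`, so `f₁` does not notice the second factor.
  have hcomm : ⁅f₁, ⁅f₂, k⁆⁆ = ⁅f₁, f₂⁆ := by
    refine h.eq_of_smul_eq fun z => ?_
    rw [commutatorElement_def f₁, commutatorElement_def f₁]
    simp only [mul_smul]
    by_cases hz : u < z ∧ z < v
    · have h1 := pres _ (inv _ s₂') z hz
      rw [kU' z hz, kU _ (pres _ (inv _ s₁) _ h1)]
    · have h1 : ¬ (u < ⁅f₂, k⁆⁻¹ • z ∧ ⁅f₂, k⁆⁻¹ • z < v) := by
        intro hc
        have := pres _ s₂' _ hc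
        rw [← kU _ hc, smul_inv_smul] at this
        exact hz this
      rw [out _ (inv _ s₁) _ h1, smul_inv_smul, out _ s₁ _ hz, out _ (inv _ s₂') _ hz,
        out _ (inv _ s₁) _ hz, out _ s₂' _ hz, out _ s₁ _ hz]
  refine ⟨f₁, f₂, comm _ s₁, comm _ s₂', ?_, ?_⟩
  · rw [hcomm, Ne, commutatorElement_eq_one_iff_mul_comm]
    intro hcm
    obtain ⟨w, hw⟩ := h.exists_ne hf₂
    have hw' : f₂ • f₁ • w ≠ f₁ • w := by
      rw [← mul_smul, ← hcm, mul_smul]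
      exact fun hc => hw (MulAction.injective f₁ hc)
    have m1 := s₂ _ hw
    have m2 := s₂ _ hw'
    exact hcd w ((le_max_right _ _).trans_lt m1.1) (m1.2.trans_le (min_le_right _ _))
      ⟨(le_max_right _ _).trans_lt m2.1, m2.2.trans_le (min_le_right _ _)⟩
  · rw [hcomm]
    have c1 : Commute f₁ g := comm _ s₁
    have c2 : Commute f₂ g := comm _ s₂'
    exact ((c1.mul_left c2).mul_left c1.inv_left).mul_left c2.inv_left

/-- If `f` and `g` move a common point, take `k` supported in a small window there, so that it fails
to commute with `f`. A double commutator as in `Disj` would commute with `g`, so its support would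
contain a whole `g`-orbit. But that support is covered by four translates of the support of `k`
under elements commuting with `g`, and each translate meets the orbit at most once. -/
theorem not_disj_of_ne [DenselyOrdered X] (h : ChainAction X G) {f g : G} {x : X}
    (hf : f • x ≠ x) (hg : g • x ≠ x) : ¬ Disj f g := by
  intro hd
  obtain ⟨a, b, ha, hb, hab⟩ := h.exists_displaced hf
  obtain ⟨a', b', ha', hb', hab'⟩ := h.exists_window hg
  obtain ⟨k, hk, sk⟩ := h.moving (a := max a a') (b := min b b')
    (lt_trans (max_lt ha ha') (lt_min hb hb'))
  have sk1 : ∀ z : X, k • z ≠ z → a < z ∧ z < b := fun z hz =>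
    ⟨(le_max_left _ _).trans_lt (sk z hz).1, (sk z hz).2.trans_le (min_le_left _ _)⟩
  have sk2 : ∀ z : X, k • z ≠ z → a' < z ∧ z < b' := fun z hz =>
    ⟨(le_max_right _ _).trans_lt (sk z hz).1, (sk z hz).2.trans_le (min_le_right _ _)⟩
  obtain ⟨f₁, f₂, c1, c2, hne, hc⟩ := hd k fun hc => by
    obtain ⟨w, hw⟩ := h.exists_ne hk
    have hw' : k • f • w ≠ f • w := by
      rw [← mul_smul, ← hc, mul_smul]
      exact fun hc => hw (MulAction.injective f hc)
    exact hab w (sk1 w hw).1 (sk1 w hw).2 (sk1 _ hw')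
  obtain ⟨z, hz⟩ := h.exists_ne hne
  -- Applied twice, this shows that a point moved by `⁅f₁, ⁅f₂, k⁆⁆` is taken into the support of
  -- `k` by one of the four elements `1`, `f₂⁻¹`, `f₁⁻¹`, `f₂⁻¹ * f₁⁻¹`.
  have hprod : ∀ (e e' : G) (w : X), (e * e' * e⁻¹ * e'⁻¹) • w ≠ w →
      e' • (e⁻¹ • w) ≠ e⁻¹ • w ∨ e' • w ≠ w := by
    intro e e' w hw
    by_contra! hcon
    apply hw
    have h1 : e'⁻¹ • w = w := by rw [inv_smul_eq_iff, hcon.2]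
    rw [mul_smul, mul_smul, mul_smul, h1, hcon.1, smul_inv_smul]
  have hmem : ∀ w : X, ⁅f₁, ⁅f₂, k⁆⁆ • w ≠ w →
      ∃ i : Fin 4, k • ((![1, f₂⁻¹, f₁⁻¹, f₂⁻¹ * f₁⁻¹] : Fin 4 → G) i • w) ≠
        (![1, f₂⁻¹, f₁⁻¹, f₂⁻¹ * f₁⁻¹] : Fin 4 → G) i • w := by
    intro w hw
    rcases hprod _ _ _ hw with h1 | h1
    · rcases hprod _ _ _ h1 with h2 | h2
      · exact ⟨3, by simpa [mul_smul] using h2⟩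
      · exact ⟨2, by simpa using h2⟩
    · rcases hprod _ _ _ h1 with h2 | h2
      · exact ⟨1, by simpa using h2⟩
      · exact ⟨0, by simpa using h2⟩
  have hcm : ∀ i : Fin 4, Commute ((![1, f₂⁻¹, f₁⁻¹, f₂⁻¹ * f₁⁻¹] : Fin 4 → G) i) g := by
    have c1 : Commute f₁⁻¹ g := Commute.inv_left c1
    have c2 : Commute f₂⁻¹ g := Commute.inv_left c2
    intro i
    fin_cases i
    · exact Commute.one_left g
    · exact c2
    · exact c1
    · exact c2.mul_left c1
  have hzn : ∀ n : ℕ, ⁅f₁, ⁅f₂, k⁆⁆ • g ^ n • z ≠ g ^ n • z := by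
    intro n hn
    have hc' : Commute ⁅f₁, ⁅f₂, k⁆⁆ (g ^ n) := Commute.pow_right hc n
    rw [← mul_smul, hc'.eq, mul_smul] at hn
    exact hz (MulAction.injective _ hn)
  choose i hi using fun n : ℕ => hmem _ (hzn n)
  -- If the same translating element served for `n < m`, it would commute past `g`, and `g ^ (m -
  -- n)` would map a point of the window into the window.
  have pigeon : ∀ n m : ℕ, n < m → i n ≠ i m := by
    intro n m hnm he
    obtain ⟨j, rfl⟩ := Nat.exists_eq_add_of_lt hnm
    have h1 := sk2 _ (hi n)
    have h2 := sk2 _ (hi (n + j + 1))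
    rw [← he] at h2
    refine hab' _ h1.1 h1.2 j ?_
    have : g ^ (j + 1) • (![1, f₂⁻¹, f₁⁻¹, f₂⁻¹ * f₁⁻¹] : Fin 4 → G) (i n) • g ^ n • z =
        (![1, f₂⁻¹, f₁⁻¹, f₂⁻¹ * f₁⁻¹] : Fin 4 → G) (i n) • g ^ (n + j + 1) • z := by
      rw [← mul_smul, ← ((hcm (i n)).pow_right (j + 1)).eq, mul_smul, ← mul_smul (g ^ (j + 1)),
        ← pow_add]
      congr 3
      omega
    rw [this]
    exact h2
  exact not_injective_infinite_finite i fun n m he => by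
    rcases lt_trichotomy n m with hl | hl | hl
    · exact absurd he (pigeon n m hl)
    · exact hl
    · exact absurd he.symm (pigeon m n hl)

theorem not_disj_iff [DenselyOrdered X] (h : ChainAction X G) {f g : G} :
    ¬ Disj f g ↔ ∃ x : X, f • x ≠ x ∧ g • x ≠ x := by
  refine ⟨fun hd => ?_, fun ⟨x, h1, h2⟩ => h.not_disj_of_ne h1 h2⟩
  by_contra! hc
  exact hd (h.disj_of_disjoint fun x => or_iff_not_imp_left.2 (hc x))

theorem _root_.LinearPermGroup.conj_smul_ne {X G : Type*} [Group G] [MulAction G X] {f k : G} {x : X} : (k * f * k⁻¹) • k • x ≠ k • x ↔ f • x ≠ x := by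
  rw [mul_smul, inv_smul_smul, mul_smul, Ne, smul_left_cancel_iff]

theorem not_disj_conj_iff [DenselyOrdered X] (h : ChainAction X G) {f g k : G} :
    ¬ Disj (k * f * k⁻¹) g ↔ ∃ x : X, f • x ≠ x ∧ g • k • x ≠ k • x := by
  rw [h.not_disj_iff]
  constructor
  · rintro ⟨x, h1, h2⟩
    refine ⟨k⁻¹ • x, ?_, by rwa [smul_inv_smul]⟩
    rwa [← conj_smul_ne (k := k), smul_inv_smul]
  · rintro ⟨x, h1, h2⟩
    exact ⟨k • x, conj_smul_ne.2 h1, h2⟩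

theorem exists_trans [DenselyOrdered X] (h : ChainAction X G) {f₁ f₂ g₁ g₂ : G}
    {x₁ x₂ y₁ y₂ : X} (hf₁ : f₁ • x₁ ≠ x₁) (hf₂ : f₂ • x₂ ≠ x₂) (hg₁ : g₁ • y₁ ≠ y₁)
    (hg₂ : g₂ • y₂ ≠ y₂) (hx : x₁ < x₂) (hy : y₁ < y₂) :
    ∃ k : G, ¬ Disj (k * f₁ * k⁻¹) g₁ ∧ ¬ Disj (k * f₂ * k⁻¹) g₂ := by
  obtain ⟨a₁, b₁, l₁, r₁, w₁⟩ := h.exists_Ioo hf₁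
  obtain ⟨a₂, b₂, l₂, r₂, w₂⟩ := h.exists_Ioo hf₂
  obtain ⟨c₁, d₁, l₃, r₃, w₃⟩ := h.exists_Ioo hg₁
  obtain ⟨c₂, d₂, l₄, r₄, w₄⟩ := h.exists_Ioo hg₂
  -- Cutting the windows at intermediate points puts the first of each pair below the second, as
  -- `trans` demands.
  obtain ⟨m, hm, hm'⟩ := exists_between hx
  obtain ⟨n, hn, hn'⟩ := exists_between hy
  obtain ⟨k, x, y, hx1, hy1, hx2, hy2⟩ := h.trans (a := a₁) (b := min b₁ m) (c := max a₂ m)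
    (d := b₂) (a' := c₁) (b' := min d₁ n) (c' := max c₂ n) (d' := d₂)
    (l₁.trans (lt_min r₁ hm)) ((min_le_right _ _).trans (le_max_right _ _))
    ((max_lt l₂ hm').trans r₂)
    (l₃.trans (lt_min r₃ hn)) ((min_le_right _ _).trans (le_max_right _ _))
    ((max_lt l₄ hn').trans r₄)
  refine ⟨k, h.not_disj_conj_iff.2 ⟨x, w₁ x hx1.1 ?_, w₃ _ hx2.1 ?_⟩,
    h.not_disj_conj_iff.2 ⟨y, w₂ y ?_ hy1.2, w₄ _ ?_ hy2.2⟩⟩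
  · exact hx1.2.trans_le (min_le_left _ _)
  · exact hx2.2.trans_le (min_le_left _ _)
  · exact (le_max_left _ _).trans_lt hy1.1
  · exact (le_max_left _ _).trans_lt hy2.1

theorem not_before_swap (h : ChainAction X G) {f g : G} (hfg : Before X f g) :
    ¬ Before X g f := by
  intro hgf
  obtain ⟨x, hx⟩ := h.exists_ne hfg.1
  obtain ⟨y, hy⟩ := h.exists_ne hfg.2.1
  exact lt_asymm (hfg.2.2 x y hx hy) (hgf.2.2 y x hy hx)

theorem sep_of_before [DenselyOrdered X] (h : ChainAction X G) {f g : G} (hfg : Before X f g) :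
    Sep f g := by
  refine ⟨hfg.1, hfg.2.1, fun ⟨k, h1, h2⟩ => ?_⟩
  obtain ⟨x, hx, hx'⟩ := h.not_disj_conj_iff.1 h1
  obtain ⟨y, hy, hy'⟩ := h.not_disj_conj_iff.1 h2
  exact lt_asymm (hfg.2.2 x y hx hy) ((h.smul_lt_iff k).1 (hfg.2.2 _ _ hy' hx'))

theorem _root_.LinearPermGroup.Sep.symm {f g : G} (hfg : Sep f g) : Sep g f :=
  ⟨hfg.2.1, hfg.1, fun ⟨k, h1, h2⟩ => hfg.2.2 ⟨k, h2, h1⟩⟩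

/-- If neither support precedes the other, either they meet and `h = 1` violates `Sep`, or they
interleave: some pair has `g` to the left of `f` and another has `f` to the left of `g`.
Transitivity then carries the first pair near the second, exchanging the roles of `f` and `g`. -/
theorem sep_iff [DenselyOrdered X] (h : ChainAction X G) {f g : G} :
    Sep f g ↔ Before X f g ∨ Before X g f := by
  refine ⟨fun hs => ?_, fun hs => hs.elim h.sep_of_before fun hs => (h.sep_of_before hs).symm⟩
  by_contra! hc
  obtain ⟨x, y, hx, hy, hxy⟩ : ∃ x y : X, f • x ≠ x ∧ g • y ≠ y ∧ y ≤ x := by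
    by_contra! hcon
    exact hc.1 ⟨hs.1, hs.2.1, hcon⟩
  obtain ⟨y', x', hy', hx', hxy'⟩ : ∃ y x : X, g • y ≠ y ∧ f • x ≠ x ∧ x ≤ y := by
    by_contra! hcon
    exact hc.2 ⟨hs.2.1, hs.1, hcon⟩
  have hno : ∀ z : X, f • z ≠ z → g • z = z := by
    intro z hz
    by_contra hz'
    refine hs.2.2 ⟨1, ?_, ?_⟩
    · simpa using h.not_disj_of_ne hz hz'
    · simpa using h.not_disj_of_ne hz' hz
  have n1 : y < x := lt_of_le_of_ne hxy fun he => hy (he ▸ hno x hx)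
  have n2 : x' < y' := lt_of_le_of_ne hxy' fun he => hy' (he ▸ hno x' hx')
  obtain ⟨k, h1, h2⟩ := h.exists_trans hy hx hx' hy' n1 n2
  exact hs.2.2 ⟨k, h2, h1⟩

theorem dir_iff [DenselyOrdered X] (h : ChainAction X G) {f₁ f₂ g₁ g₂ : G} :
    Dir f₁ f₂ g₁ g₂ ↔ (Before X f₁ f₂ ∧ Before X g₁ g₂) ∨ (Before X f₂ f₁ ∧ Before X g₂ g₁) := by
  have key : ∀ {f₁ f₂ g₁ g₂ : G}, Before X f₁ f₂ → Before X g₂ g₁ → ∀ k : G,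
      ¬ Disj (k * f₁ * k⁻¹) g₁ → ¬ Disj (k * f₂ * k⁻¹) g₂ → False := by
    intro f₁ f₂ g₁ g₂ hf hg k h1 h2
    obtain ⟨x, hx, hx'⟩ := h.not_disj_conj_iff.1 h1
    obtain ⟨y, hy, hy'⟩ := h.not_disj_conj_iff.1 h2
    exact lt_asymm ((h.smul_lt_iff k).2 (hf.2.2 x y hx hy)) (hg.2.2 _ _ hy' hx')
  have pos : ∀ {f₁ f₂ g₁ g₂ : G}, Before X f₁ f₂ → Before X g₁ g₂ → ∃ k : G,
      ¬ Disj (k * f₁ * k⁻¹) g₁ ∧ ¬ Disj (k * f₂ * k⁻¹) g₂ := by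
    intro f₁ f₂ g₁ g₂ hf hg
    obtain ⟨x₁, m₁⟩ := h.exists_ne hf.1
    obtain ⟨x₂, m₂⟩ := h.exists_ne hf.2.1
    obtain ⟨y₁, m₃⟩ := h.exists_ne hg.1
    obtain ⟨y₂, m₄⟩ := h.exists_ne hg.2.1
    exact h.exists_trans m₁ m₂ m₃ m₄ (hf.2.2 _ _ m₁ m₂) (hg.2.2 _ _ m₃ m₄)
  constructor
  · rintro ⟨s1, s2, k, h1, h2⟩
    rcases h.sep_iff.1 s1 with a | a <;> rcases h.sep_iff.1 s2 with b | b
    · exact .inl ⟨a, b⟩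
    · exact (key a b k h1 h2).elim
    · exact (key a b k h2 h1).elim
    · exact .inr ⟨a, b⟩
  · rintro (⟨a, b⟩ | ⟨a, b⟩)
    · exact ⟨h.sep_of_before a, h.sep_of_before b, pos a b⟩
    · obtain ⟨k, h1, h2⟩ := pos a b
      exact ⟨(h.sep_of_before a).symm, (h.sep_of_before b).symm, k, h2, h1⟩

/-- A fixed ordered pair acts as a compass: relative to it the order of supports is definable,
although the orientation itself is not. -/
theorem dir_iff_of_before [DenselyOrdered X] (h : ChainAction X G) {p q f g : G}
    (hpq : Before X p q) : Dir p q f g ↔ Before X f g := by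
  rw [h.dir_iff]
  refine ⟨fun h1 => h1.elim And.right fun h2 => (h.not_before_swap hpq h2.1).elim,
    fun h1 => .inl ⟨hpq, h1⟩⟩

end ChainAction

end LinearPermGroup

/-! ### Endpoints of supports named by triples of group elements. -/

namespace LinearPermGroup

/-- The triple `(g, p, q)` denotes the last point of the closure of the support of `g`, in the
direction from `p` to `q`. -/
def Valid {G : Type*} [Group G] (t : Fin 3 → G) : Prop := ∃ f, Dir (t 1) (t 2) (t 0) f

/-- The support of `f` lies on the far side of the point denoted by a triple. -/
def FarSide {G : Type*} [Group G] (t : Fin 3 → G) (f : G) : Prop := Dir (t 1) (t 2) (t 0) f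

/-- The support of `f` lies on the near side of the point denoted by a triple. -/
def NearSide {G : Type*} [Group G] (t : Fin 3 → G) (f : G) : Prop :=
  f ≠ 1 ∧ ∀ k, Dir (t 1) (t 2) (t 0) k → Dir (t 1) (t 2) f k

/-- In the direction from `p` to `q`, the support of `f` comes after the point denoted by a
triple. -/
def After {G : Type*} [Group G] (p q : G) (t : Fin 3 → G) (f : G) : Prop :=
  (Dir p q (t 1) (t 2) ∧ FarSide t f) ∨ (Dir p q (t 2) (t 1) ∧ NearSide t f)

/-- The order of the points denoted by triples, in the direction from `p` to `q`. -/
def PointLt {G : Type*} [Group G] (p q : G) (t t' : Fin 3 → G) : Prop :=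
  ∃ f, After p q t f ∧ After q p t' f

/-- The equal direction relation for points denoted by triples. -/
def PointEd {G : Type*} [Group G] (t₁ t₂ t₃ t₄ : Fin 3 → G) : Prop :=
  Valid t₁ ∧ Valid t₂ ∧ Valid t₃ ∧ Valid t₄ ∧
    ∃ p q, Sep p q ∧ PointLt p q t₁ t₂ ∧ PointLt p q t₃ t₄

/-- Equality of points denoted by triples. -/
def PointEq {G : Type*} [Group G] (t t' : Fin 3 → G) : Prop :=
  Valid t ∧ Valid t' ∧ ¬ ∃ p q, Sep p q ∧ PointLt p q t t'

/-- Application of a group element to a point denoted by a triple. -/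
def conjTriple {G : Type*} [Group G] (k : G) (t : Fin 3 → G) : Fin 3 → G :=
  ![k * t 0 * k⁻¹, t 1, t 2]

/-- The triple `t` denotes the point `x`. -/
def IsPt {X G : Type*} [LinearOrder X] [Group G] [MulAction G X] (t : Fin 3 → G) (x : X) : Prop :=
  (Before X (t 1) (t 2) ∧ IsLUB {y : X | t 0 • y ≠ y} x) ∨
    (Before X (t 2) (t 1) ∧ IsGLB {y : X | t 0 • y ≠ y} x)

section

variable {X G : Type*} [LinearOrder X] [Group G] [MulAction G X]

theorem Before.dual {f g : G} (h : Before X f g) : Before Xᵒᵈ g f :=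
  ⟨h.2.1, h.1, fun x y hx hy => h.2.2 y x hy hx⟩

theorem IsPt.dual {t : Fin 3 → G} {x : X} (h : IsPt t x) : IsPt t (OrderDual.toDual x) :=
  h.elim (fun h => .inr ⟨h.1.dual, h.2⟩) fun h => .inl ⟨h.1.dual, h.2⟩

end

theorem ne_one_of_smul_ne {X G : Type*} [Group G] [MulAction G X] {g : G} {x : X} (hx : g • x ≠ x) : g ≠ 1 := by
  rintro rfl
  exact hx (one_smul _ _)

namespace ChainAction

variable {X G : Type*} [LinearOrder X] [Group G] [MulAction G X]

theorem exists_before [Nonempty X] [NoMaxOrder X] (h : ChainAction X G) :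
    ∃ p q : G, Before X p q := by
  obtain ⟨a⟩ := ‹Nonempty X›
  obtain ⟨b, hb⟩ := exists_gt a
  obtain ⟨c, hc⟩ := exists_gt b
  obtain ⟨p, hp, hp'⟩ := h.moving hb
  obtain ⟨q, hq, hq'⟩ := h.moving hc
  exact ⟨p, q, hp, hq, fun x y hx hy => (hp' x hx).2.trans (hq' y hy).1⟩

theorem isPt_unique (h : ChainAction X G) {t : Fin 3 → G} {x y : X} (hx : IsPt t x)
    (hy : IsPt t y) : x = y := by
  rcases hx with ⟨a, b⟩ | ⟨a, b⟩ <;> rcases hy with ⟨c, d⟩ | ⟨c, d⟩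
  · exact b.unique d
  · exact (h.not_before_swap a c).elim
  · exact (h.not_before_swap a c).elim
  · exact b.unique d

theorem smul_le_iff (h : ChainAction X G) (k : G) {x y : X} : k • x ≤ k • y ↔ x ≤ y := by
  rw [← not_lt, h.smul_lt_iff, not_lt]

theorem isLUB_conj (h : ChainAction X G) {g : G} {x : X} (k : G)
    (hx : IsLUB {y : X | g • y ≠ y} x) : IsLUB {y : X | (k * g * k⁻¹) • y ≠ y} (k • x) := by
  refine ⟨fun y hy => ?_, fun z hz => ?_⟩
  · rw [← smul_inv_smul k y, h.smul_le_iff]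
    refine hx.1 ?_
    rwa [Set.mem_ofPred_eq, ← conj_smul_ne (k := k), smul_inv_smul]
  · rw [← smul_inv_smul k z, h.smul_le_iff]
    refine hx.2 fun y hy => ?_
    rw [← h.smul_le_iff k, smul_inv_smul]
    exact hz (conj_smul_ne.2 hy)

/-- Only the first entry is conjugated: the other two merely give a direction, which order
automorphisms respect. -/
theorem isPt_conjTriple (h : ChainAction X G) {t : Fin 3 → G} {x : X} (k : G) (ht : IsPt t x) :
    IsPt (conjTriple k t) (k • x) :=
  ht.elim (fun ht => .inl ⟨ht.1, h.isLUB_conj k ht.2⟩)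
    fun ht => .inr ⟨ht.1, h.dual.isLUB_conj k ht.2⟩

theorem ne_one_of_isLUB [NoMinOrder X] {g : G} {x : X} (hx : IsLUB {y : X | g • y ≠ y} x) :
    g ≠ 1 := by
  obtain ⟨y, hy⟩ := hx.nonempty
  exact ne_one_of_smul_ne hy

variable [DenselyOrdered X]

/-- Supports are open, so they do not contain an upper bound of themselves. -/
theorem lt_of_forall_le (h : ChainAction X G) {g : G} {x z : X}
    (hx : ∀ y : X, g • y ≠ y → y ≤ x) (hz : g • z ≠ z) : z < x := by
  obtain ⟨a, b, h1, h2, h3⟩ := h.exists_Ioo hz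
  obtain ⟨w, hw, hw'⟩ := exists_between h2
  exact hw.trans_le (hx w (h3 w (h1.trans hw) hw'))

theorem gt_of_forall_ge (h : ChainAction X G) {g : G} {x z : X}
    (hx : ∀ y : X, g • y ≠ y → x ≤ y) (hz : g • z ≠ z) : x < z :=
  h.dual.lt_of_forall_le (x := OrderDual.toDual x) (z := OrderDual.toDual z) hx hz

theorem before_iff_of_isLUB [NoMinOrder X] (h : ChainAction X G) {g f : G} {x : X}
    (hx : IsLUB {y : X | g • y ≠ y} x) :
    Before X g f ↔ f ≠ 1 ∧ ∀ y : X, f • y ≠ y → x ≤ y := by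
  constructor
  · exact fun hb => ⟨hb.2.1, fun y hy => hx.2 fun z hz => (hb.2.2 z y hz hy).le⟩
  · exact fun hb => ⟨ne_one_of_isLUB hx, hb.1, fun z y hz hy =>
      (h.lt_of_forall_le (fun w hw => hx.1 hw) hz).trans_le (hb.2 y hy)⟩

theorem farSide_iff [NoMinOrder X] (h : ChainAction X G) {t : Fin 3 → G} {f : G} {x : X}
    (ht : Before X (t 1) (t 2)) (hx : IsLUB {y : X | t 0 • y ≠ y} x) :
    FarSide t f ↔ f ≠ 1 ∧ ∀ y : X, f • y ≠ y → x ≤ y := by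
  rw [FarSide, h.dir_iff_of_before ht, h.before_iff_of_isLUB hx]

/-- If `f` moved a point `y` beyond `x`, some nontrivial `k` would be supported between `x` and `y`
inside the support of `f`; it lies on the far side of `x` without lying beyond `f`. -/
theorem nearSide_iff [NoMinOrder X] (h : ChainAction X G) {t : Fin 3 → G} {f : G} {x : X}
    (ht : Before X (t 1) (t 2)) (hx : IsLUB {y : X | t 0 • y ≠ y} x) :
    NearSide t f ↔ f ≠ 1 ∧ ∀ y : X, f • y ≠ y → y ≤ x := by
  simp only [NearSide, h.dir_iff_of_before ht, h.before_iff_of_isLUB hx]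
  refine and_congr_right fun hf => ⟨fun hk y hy => ?_, fun hb k hk => ⟨hf, hk.1, fun y z hy hz =>
    (h.lt_of_forall_le hb hy).trans_le (hk.2 z hz)⟩⟩
  by_contra! hxy
  obtain ⟨a, b, h1, h2, h3⟩ := h.exists_Ioo hy
  obtain ⟨k, hk1, hk2⟩ := h.moving (a := max a x) (b := y) (max_lt h1 hxy)
  obtain ⟨z, hz⟩ := h.exists_ne hk1
  have hb := hk k ⟨hk1, fun y hy => ((le_max_right _ _).trans_lt (hk2 y hy).1).le⟩
  exact lt_irrefl z (hb.2.2 z z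
    (h3 z ((le_max_left _ _).trans_lt (hk2 z hz).1) ((hk2 z hz).2.trans h2)) hz)

theorem after_iff [NoMinOrder X] [NoMaxOrder X] (h : ChainAction X G) {p q : G} {t : Fin 3 → G}
    {f : G} {x : X} (hpq : Before X p q) (ht : IsPt t x) :
    After p q t f ↔ f ≠ 1 ∧ ∀ y : X, f • y ≠ y → x ≤ y := by
  rw [After, h.dir_iff_of_before hpq, h.dir_iff_of_before hpq]
  rcases ht with ht | ht
  · rw [h.farSide_iff ht.1 ht.2]
    exact ⟨fun hc => hc.elim And.right fun hc => (h.not_before_swap ht.1 hc.1).elim,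
      fun hc => .inl ⟨ht.1, hc⟩⟩
  · rw [h.dual.nearSide_iff ht.1.dual ht.2]
    exact ⟨fun hc => hc.elim (fun hc => (h.not_before_swap ht.1 hc.1).elim) And.right,
      fun hc => .inr ⟨ht.1, hc⟩⟩

/-- By local movement, `x < x'` exactly when a nontrivial support fits between them. -/
theorem pointLt_iff [NoMinOrder X] [NoMaxOrder X] (h : ChainAction X G) {p q : G}
    {t t' : Fin 3 → G} {x x' : X} (hpq : Before X p q) (ht : IsPt t x) (ht' : IsPt t' x') :
    PointLt p q t t' ↔ x < x' := by
  simp only [PointLt, h.after_iff hpq ht, h.dual.after_iff hpq.dual ht'.dual]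
  constructor
  · rintro ⟨f, ⟨hf, h1⟩, -, h2⟩
    obtain ⟨z, hz⟩ := h.exists_ne hf
    exact (h.gt_of_forall_ge h1 hz).trans_le (h2 z hz)
  · intro hx
    obtain ⟨f, hf, hs⟩ := h.moving hx
    exact ⟨f, ⟨hf, fun y hy => (hs y hy).1.le⟩, hf, fun y hy => (hs y hy).2.le⟩

theorem valid_of_isPt [NoMinOrder X] [NoMaxOrder X] (h : ChainAction X G) {t : Fin 3 → G} {x : X}
    (ht : IsPt t x) : Valid t := by
  rcases ht with ht | ht
  · obtain ⟨y, hy⟩ := exists_gt x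
    obtain ⟨f, hf, hs⟩ := h.moving hy
    exact ⟨f, (h.farSide_iff ht.1 ht.2).2 ⟨hf, fun y hy => (hs y hy).1.le⟩⟩
  · obtain ⟨y, hy⟩ := exists_lt x
    obtain ⟨f, hf, hs⟩ := h.moving hy
    exact ⟨f, (h.dual.farSide_iff ht.1.dual ht.2).2 ⟨hf, fun y hy => (hs y hy).2.le⟩⟩

/-- The witness of validity bounds the support of `t 0` on the chosen side, so completeness provides
the endpoint. -/
theorem exists_isPt_of_valid (h : ChainAction X G)
    (hc : ∀ S : Set X, S.Nonempty → BddAbove S → ∃ x, IsLUB S x)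
    (hc' : ∀ S : Set X, S.Nonempty → BddBelow S → ∃ x, IsGLB S x) {t : Fin 3 → G}
    (ht : Valid t) : ∃ x : X, IsPt t x := by
  obtain ⟨f, hf⟩ := ht
  rcases h.dir_iff.1 hf with ⟨h1, h2⟩ | ⟨h1, h2⟩
  · obtain ⟨z, hz⟩ := h.exists_ne h2.2.1
    obtain ⟨x, hx⟩ := hc {y : X | t 0 • y ≠ y} (h.exists_ne h2.1)
      ⟨z, fun y hy => (h2.2.2 y z hy hz).le⟩
    exact ⟨x, .inl ⟨h1, hx⟩⟩
  · obtain ⟨z, hz⟩ := h.exists_ne h2.1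
    obtain ⟨x, hx⟩ := hc' {y : X | t 0 • y ≠ y} (h.exists_ne h2.2.1)
      ⟨z, fun y hy => (h2.2.2 z y hz hy).le⟩
    exact ⟨x, .inr ⟨h1, hx⟩⟩

theorem pointEd_iff [Nonempty X] [NoMinOrder X] [NoMaxOrder X] (h : ChainAction X G)
    {t₁ t₂ t₃ t₄ : Fin 3 → G} {x₁ x₂ x₃ x₄ : X} (h₁ : IsPt t₁ x₁) (h₂ : IsPt t₂ x₂)
    (h₃ : IsPt t₃ x₃) (h₄ : IsPt t₄ x₄) : PointEd t₁ t₂ t₃ t₄ ↔ Ed x₁ x₂ x₃ x₄ := by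
  constructor
  · rintro ⟨-, -, -, -, p, q, hpq, a, b⟩
    rcases h.sep_iff.1 hpq with hpq | hpq
    · exact .inl ⟨(h.pointLt_iff hpq h₁ h₂).1 a, (h.pointLt_iff hpq h₃ h₄).1 b⟩
    · exact .inr ⟨(h.dual.pointLt_iff hpq.dual h₁.dual h₂.dual).1 a,
        (h.dual.pointLt_iff hpq.dual h₃.dual h₄.dual).1 b⟩
  · intro he
    refine ⟨h.valid_of_isPt h₁, h.valid_of_isPt h₂, h.valid_of_isPt h₃, h.valid_of_isPt h₄, ?_⟩
    obtain ⟨p, q, hpq⟩ := h.exists_before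
    rcases he with he | he
    · exact ⟨p, q, h.sep_of_before hpq, (h.pointLt_iff hpq h₁ h₂).2 he.1,
        (h.pointLt_iff hpq h₃ h₄).2 he.2⟩
    · exact ⟨q, p, (h.sep_of_before hpq).symm,
        (h.dual.pointLt_iff hpq.dual h₁.dual h₂.dual).2 he.1,
        (h.dual.pointLt_iff hpq.dual h₃.dual h₄.dual).2 he.2⟩

theorem pointEq_iff [Nonempty X] [NoMinOrder X] [NoMaxOrder X] (h : ChainAction X G)
    {t t' : Fin 3 → G} {x x' : X} (ht : IsPt t x) (ht' : IsPt t' x') : PointEq t t' ↔ x = x' := by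
  constructor
  · rintro ⟨-, -, hn⟩
    by_contra hx
    obtain ⟨p, q, hpq⟩ := h.exists_before
    rcases lt_or_gt_of_ne hx with hx | hx
    · exact hn ⟨p, q, h.sep_of_before hpq, (h.pointLt_iff hpq ht ht').2 hx⟩
    · exact hn ⟨q, p, (h.sep_of_before hpq).symm,
        (h.dual.pointLt_iff hpq.dual ht.dual ht'.dual).2 hx⟩
  · rintro rfl
    refine ⟨h.valid_of_isPt ht, h.valid_of_isPt ht', ?_⟩
    rintro ⟨p, q, hpq, hl⟩
    rcases h.sep_iff.1 hpq with hpq | hpq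
    · exact lt_irrefl _ ((h.pointLt_iff hpq ht ht').1 hl)
    · exact lt_irrefl _ ((h.dual.pointLt_iff hpq.dual ht.dual ht'.dual).1 hl)

end ChainAction

end LinearPermGroup

/-! ### Order properties of the Dedekind completion. -/

namespace DedekindCompletion

variable {L : Type*} [LinearOrder L]

section

theorem exists_principal_between [DenselyOrdered L] {a b : DedekindCut L} (h : a < b) :
    ∃ u, a < DedekindCut.principal u ∧ DedekindCut.principal u < b := by
  -- One of the two inequalities around each principal cut so obtained is weak; two such cuts and a
  -- point strictly between them make both ends strict.
  obtain ⟨c, hac, hcb⟩ := DedekindCut.lt_iff_exists.mp h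
  obtain ⟨d, had, hdc⟩ := DedekindCut.lt_iff_exists'.mp hac
  obtain ⟨u, h1, h2⟩ := exists_between (DedekindCut.principal_lt_principal.1 hdc)
  exact ⟨u, had.trans_lt (DedekindCut.principal_lt_principal.2 h1),
    hcb.trans_lt' (DedekindCut.principal_lt_principal.2 h2)⟩

variable [NoMinOrder L] [NoMaxOrder L]

/-- The embedding of a chain without endpoints in its Dedekind completion. -/
def of (x : L) : DedekindCompletion L :=
  ⟨DedekindCut.principal x, by
    obtain ⟨y, hy⟩ := exists_lt x
    exact (bot_le.trans_lt (DedekindCut.principal_lt_principal.2 hy)).ne', by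
    obtain ⟨y, hy⟩ := exists_gt x
    exact ((DedekindCut.principal_lt_principal.2 hy).trans_le le_top).ne⟩

theorem of_lt_of {x y : L} : of x < of y ↔ x < y := DedekindCut.principal_lt_principal

theorem smul_of (g : L ≃o L) (x : L) : g • of x = of (g x) :=
  Subtype.ext (DedekindCut.ext (g.image_Iic x))

variable [DenselyOrdered L]

theorem exists_of_between {a b : DedekindCompletion L} (h : a < b) :
    ∃ u, a < of u ∧ of u < b :=
  exists_principal_between (a := a.1) (b := b.1) h

theorem exists_of_lt (a : DedekindCompletion L) : ∃ u, of u < a := by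
  obtain ⟨u, -, hu⟩ := exists_principal_between (bot_lt_iff_ne_bot.2 a.2.1)
  exact ⟨u, hu⟩

theorem exists_lt_of (a : DedekindCompletion L) : ∃ u, a < of u := by
  obtain ⟨u, hu, -⟩ := exists_principal_between (lt_top_iff_ne_top.2 a.2.2)
  exact ⟨u, hu⟩

instance : DenselyOrdered (DedekindCompletion L) where
  dense _ _ h := (exists_of_between h).imp' of fun _ => id

instance : NoMinOrder (DedekindCompletion L) where
  exists_lt a := (exists_of_lt a).imp' of fun _ => id

instance : NoMaxOrder (DedekindCompletion L) where
  exists_gt a := (exists_lt_of a).imp' of fun _ => id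

instance [Nonempty L] : Nonempty (DedekindCompletion L) := Nonempty.map of inferInstance

end

theorem exists_isLUB (S : Set (DedekindCompletion L)) (hS : S.Nonempty) (hb : BddAbove S) :
    ∃ x, IsLUB S x := by
  obtain ⟨s, hs⟩ := hS
  obtain ⟨b, hb⟩ := hb
  have h1 : s.1 ≤ sSup (Subtype.val '' S) := le_sSup ⟨s, hs, rfl⟩
  have h2 : sSup (Subtype.val '' S) ≤ b.1 := sSup_le fun _ ⟨t, ht, he⟩ => he ▸ hb ht
  refine ⟨⟨sSup (Subtype.val '' S), ?_, ?_⟩, fun t ht => ?_, fun c hc => ?_⟩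
  · exact ((bot_lt_iff_ne_bot.2 s.2.1).trans_le h1).ne'
  · exact (h2.trans_lt (lt_top_iff_ne_top.2 b.2.2)).ne
  · exact le_sSup (α := DedekindCut L) ⟨t, ht, rfl⟩
  · exact sSup_le (α := DedekindCut L) fun _ ⟨t, ht, he⟩ => he ▸ hc ht

theorem exists_isGLB (S : Set (DedekindCompletion L)) (hS : S.Nonempty) (hb : BddBelow S) :
    ∃ x, IsGLB S x := by
  obtain ⟨x, hx⟩ := exists_isLUB (lowerBounds S) hb (hS.imp fun s hs _ ht => ht hs)
  exact ⟨x, isLUB_lowerBounds.1 hx⟩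

end DedekindCompletion

/-! ### The action on the completion is locally moving and 2-interval-transitive. -/

namespace LinearPermGroup

open DedekindCompletion

variable {L : Type*} [LinearOrder L]

theorem isOpen_supp (g : L ≃o L) : IsOpen (supp g) :=
  isOpen_ne_fun (extend g).continuous continuous_id

theorem supp_subset_var (g : L ≃o L) : supp g ⊆ var g :=
  interior_maximal subset_closure (isOpen_supp g)

theorem subset_hull {X : Type*} [LinearOrder X] (U : Set X) : U ⊆ hull U :=
  fun x hx => ⟨x, hx, x, hx, le_rfl, le_rfl⟩

/-- The set `var g` lies between the support and its closure, and neither closure nor convex hull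
changes the upper bounds. -/
theorem upperBounds_hull_var (g : L ≃o L) : upperBounds (hull (var g)) = upperBounds (supp g) := by
  refine Set.Subset.antisymm
    (upperBounds_mono_set ((supp_subset_var g).trans (subset_hull _))) fun b hb => ?_
  rintro z ⟨x, -, y, hy, -, hzy⟩
  rw [← upperBounds_closure] at hb
  exact hzy.trans (hb (interior_subset hy))

theorem lowerBounds_hull_var (g : L ≃o L) : lowerBounds (hull (var g)) = lowerBounds (supp g) := by
  refine Set.Subset.antisymm
    (lowerBounds_mono_set ((supp_subset_var g).trans (subset_hull _))) fun b hb => ?_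
  rintro z ⟨x, hx, y, -, hxz, -⟩
  rw [← lowerBounds_closure] at hb
  exact (hb (interior_subset hx)).trans hxz

theorem increasing_pair [DenselyOrdered L] {a b c d : L} (hab : a < b) (hbc : b ≤ c) (hcd : c < d) :
    Increasing ![Set.Ioo a b, Set.Ioo c d] := by
  refine ⟨Fin.forall_fin_two.2 ⟨Set.nonempty_Ioo.2 hab, Set.nonempty_Ioo.2 hcd⟩, fun x hx => ?_⟩
  have h0 : x 0 ∈ Set.Ioo a b := hx 0
  have h1 : x 1 ∈ Set.Ioo c d := hx 1
  refine Fin.strictMono_iff_lt_succ.2 fun i => ?_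
  fin_cases i
  exact h0.2.trans_le (hbc.trans h1.1.le)

variable [DenselyOrdered L] [NoMinOrder L] [NoMaxOrder L]

theorem mem_Ep_iff {G : Subgroup (L ≃o L)} {x : DedekindCompletion L} :
    x ∈ Ep G ↔ ∃ g ∈ G, IsLUB (supp g) x ∨ IsGLB (supp g) x := by
  refine exists_congr fun g => and_congr_right fun _ => ?_
  have h1 : IsLUB (hull (var g)) x ↔ IsLUB (supp g) x := by
    rw [IsLUB, upperBounds_hull_var, ← IsLUB]
  have h2 : IsGLB (hull (var g)) x ↔ IsGLB (supp g) x := by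
    rw [IsGLB, lowerBounds_hull_var, ← IsGLB]
  rw [endpoints, Set.mem_ofPred_eq, h1, h2, or_comm, and_iff_right_iff_imp]
  exact fun h => (h.elim IsLUB.nonempty IsGLB.nonempty).mono
    ((supp_subset_var g).trans (subset_hull _))

/-- Local movement comes from conjugating the given bounded element into an arbitrary interval; the
other clauses pass to the completion by density of the chain in it. -/
theorem chainAction {G : Subgroup (L ≃o L)} (htrans : IntervalTransitive 2 G)
    (hbdd : ∃ g ∈ G, g ≠ 1 ∧ IsBoundedElement g) : ChainAction (DedekindCompletion L) G where
  smul_lt g _ _ h := (extend (g : L ≃o L)).strictMono h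
  eq_one g hg := Subtype.ext <| OrderIso.ext <| funext fun x => by
    have h : (g : L ≃o L) • of x = of x := hg (of x)
    rw [smul_of] at h
    exact DedekindCut.principal_inj.1 (congrArg Subtype.val h)
  moving {a b} hab := by
    obtain ⟨k, hk, hk1, A, B, hAB, hs⟩ := hbdd
    obtain ⟨l, hl⟩ := exists_of_lt A
    obtain ⟨r, hr⟩ := exists_lt_of B
    obtain ⟨x, hax, hxb⟩ := exists_of_between hab
    obtain ⟨y, hxy, hyb⟩ := exists_of_between hxb
    obtain ⟨z, hyz, hzb⟩ := exists_of_between hyb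
    -- The two rays lie on either side of the support of `k`. Moving a point of each into `(x, y)`
    -- and `(y, z)` squeezes the support into `(x, z)`.
    obtain ⟨g, hg, hi⟩ := htrans ![Set.Iio l, Set.Ioi r] ![Set.Ioo x y, Set.Ioo y z]
      (Fin.forall_fin_two.2 ⟨.inr (.inl ⟨l, rfl⟩), .inr (.inr (.inl ⟨r, rfl⟩))⟩)
      (Fin.forall_fin_two.2 ⟨.inl ⟨x, y, of_lt_of.1 hxy, rfl⟩, .inl ⟨y, z, of_lt_of.1 hyz, rfl⟩⟩)
      (by
        refine ⟨Fin.forall_fin_two.2 ⟨Set.nonempty_Iio, Set.nonempty_Ioi⟩, fun v hv => ?_⟩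
        have h0 : v 0 ∈ Set.Iio l := hv 0
        have h1 : v 1 ∈ Set.Ioi r := hv 1
        refine Fin.strictMono_iff_lt_succ.2 fun i => ?_
        fin_cases i
        exact (h0.trans (of_lt_of.1 (hl.trans (hAB.trans hr)))).trans h1)
      (increasing_pair (of_lt_of.1 hxy) le_rfl (of_lt_of.1 hyz))
    obtain ⟨⟨_, ⟨u, hu, rfl⟩, hu'⟩, ⟨_, ⟨v, hv, rfl⟩, hv'⟩⟩ := Fin.forall_fin_two.1 hi
    refine ⟨⟨g, hg⟩ * ⟨k, hk⟩ * ⟨g, hg⟩⁻¹, fun h => hk1 ?_, fun w hw => ?_⟩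
    · exact congrArg Subtype.val (conj_eq_one_iff.1 h)
    · rw [← smul_inv_smul (⟨g, hg⟩ : G) w, conj_smul_ne] at hw
      have hw' : A < (⟨g, hg⟩ : G)⁻¹ • w ∧ (⟨g, hg⟩ : G)⁻¹ • w < B := hs hw
      have h1 : of u < (⟨g, hg⟩ : G)⁻¹ • w := ((of_lt_of.2 hu).trans hl).trans hw'.1
      have h2 : (⟨g, hg⟩ : G)⁻¹ • w < of v := hw'.2.trans (hr.trans (of_lt_of.2 hv))
      have h3 : g • of u < g • (⟨g, hg⟩ : G)⁻¹ • w := (extend g).strictMono h1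
      have h4 : g • (⟨g, hg⟩ : G)⁻¹ • w < g • of v := (extend g).strictMono h2
      have h5 : g • (⟨g, hg⟩ : G)⁻¹ • w = w := smul_inv_smul (⟨g, hg⟩ : G) w
      rw [h5, smul_of] at h3 h4
      exact ⟨(hax.trans (of_lt_of.2 hu'.1)).trans h3, h4.trans ((of_lt_of.2 hv'.2).trans hzb)⟩
  trans := by
    have pick : ∀ {a b : DedekindCompletion L}, a < b → ∃ x y, a < of x ∧ x < y ∧ of y < b := by
      intro a b hab
      obtain ⟨x, hax, hxb⟩ := exists_of_between hab
      obtain ⟨y, hxy, hyb⟩ := exists_of_between hxb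
      exact ⟨x, y, hax, of_lt_of.1 hxy, hyb⟩
    intro a b c d a' b' c' d' h1 h2 h3 h4 h5 h6
    obtain ⟨x₁, y₁, p₁, q₁, r₁⟩ := pick h1
    obtain ⟨x₂, y₂, p₂, q₂, r₂⟩ := pick h3
    obtain ⟨x₃, y₃, p₃, q₃, r₃⟩ := pick h4
    obtain ⟨x₄, y₄, p₄, q₄, r₄⟩ := pick h6
    obtain ⟨g, hg, hi⟩ := htrans ![Set.Ioo x₁ y₁, Set.Ioo x₂ y₂] ![Set.Ioo x₃ y₃, Set.Ioo x₄ y₄]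
      (Fin.forall_fin_two.2 ⟨.inl ⟨x₁, y₁, q₁, rfl⟩, .inl ⟨x₂, y₂, q₂, rfl⟩⟩)
      (Fin.forall_fin_two.2 ⟨.inl ⟨x₃, y₃, q₃, rfl⟩, .inl ⟨x₄, y₄, q₄, rfl⟩⟩)
      (increasing_pair q₁ (of_lt_of.1 (r₁.trans_le (h2.trans p₂.le))).le q₂)
      (increasing_pair q₃ (of_lt_of.1 (r₃.trans_le (h5.trans p₄.le))).le q₄)
    obtain ⟨⟨_, ⟨u, hu, rfl⟩, hu'⟩, ⟨_, ⟨v, hv, rfl⟩, hv'⟩⟩ := Fin.forall_fin_two.1 hi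
    refine ⟨⟨g, hg⟩, of u, of v, ⟨?_, ?_⟩, ⟨?_, ?_⟩, ?_, ?_⟩
    · exact p₁.trans (of_lt_of.2 hu.1)
    · exact (of_lt_of.2 hu.2).trans r₁
    · exact p₂.trans (of_lt_of.2 hv.1)
    · exact (of_lt_of.2 hv.2).trans r₂
    · change a' < g • of u ∧ g • of u < b'
      rw [smul_of]
      exact ⟨p₃.trans (of_lt_of.2 hu'.1), (of_lt_of.2 hu'.2).trans r₃⟩
    · change c' < g • of v ∧ g • of v < d'
      rw [smul_of]
      exact ⟨p₄.trans (of_lt_of.2 hv'.1), (of_lt_of.2 hv'.2).trans r₄⟩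

end LinearPermGroup

/-! ### Predicates defined by one formula in two groups. -/

namespace LinearPermGroup

open FirstOrder FirstOrder.Language

open scoped commutatorElement

/-- A predicate on one group and a predicate on another are defined by the same formula of the
language of groups. -/
def JointDef {G₁ G₂ : Type*} [Group G₁] [Group G₂] {α : Type}
    (P₁ : (α → G₁) → Prop) (P₂ : (α → G₂) → Prop) : Prop :=
  ∃ φ : groupLang.Formula α, (∀ v, φ.Realize v ↔ P₁ v) ∧ ∀ v, φ.Realize v ↔ P₂ v

/-- A function on one group and a function on another have graphs defined by the same formula of
the language of groups. -/
def JointFun {G₁ G₂ : Type*} [Group G₁] [Group G₂] {α : Type}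
    (F₁ : (α → G₁) → G₁) (F₂ : (α → G₂) → G₂) : Prop :=
  JointDef (α := α ⊕ Unit) (fun w => w (.inr ()) = F₁ (w ∘ Sum.inl))
    (fun w => w (.inr ()) = F₂ (w ∘ Sum.inl))

section

variable {G₁ G₂ : Type*} [Group G₁] [Group G₂] {α β : Type}

namespace JointDef

variable {P₁ Q₁ : (α → G₁) → Prop} {P₂ Q₂ : (α → G₂) → Prop}

theorem congr (h : JointDef P₁ P₂) (h₁ : ∀ v, Q₁ v ↔ P₁ v) (h₂ : ∀ v, Q₂ v ↔ P₂ v) :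
    JointDef Q₁ Q₂ := by
  obtain ⟨φ, hφ₁, hφ₂⟩ := h
  exact ⟨φ, fun v => (hφ₁ v).trans (h₁ v).symm, fun v => (hφ₂ v).trans (h₂ v).symm⟩

theorem false : JointDef (fun _ : α → G₁ => False) (fun _ : α → G₂ => False) :=
  ⟨⊥, by simp, by simp⟩

theorem imp (hP : JointDef P₁ P₂) (hQ : JointDef Q₁ Q₂) :
    JointDef (fun v => P₁ v → Q₁ v) (fun v => P₂ v → Q₂ v) := by
  obtain ⟨φ, hφ₁, hφ₂⟩ := hP
  obtain ⟨ψ, hψ₁, hψ₂⟩ := hQ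
  exact ⟨φ.imp ψ, fun v => by rw [Formula.realize_imp, hφ₁, hψ₁],
    fun v => by rw [Formula.realize_imp, hφ₂, hψ₂]⟩

theorem not (hP : JointDef P₁ P₂) : JointDef (fun v => ¬ P₁ v) (fun v => ¬ P₂ v) := hP.imp false

theorem and (hP : JointDef P₁ P₂) (hQ : JointDef Q₁ Q₂) :
    JointDef (fun v => P₁ v ∧ Q₁ v) (fun v => P₂ v ∧ Q₂ v) :=
  (hP.imp hQ.not).not.congr (fun _ => by tauto) fun _ => by tauto

theorem or (hP : JointDef P₁ P₂) (hQ : JointDef Q₁ Q₂) :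
    JointDef (fun v => P₁ v ∨ Q₁ v) (fun v => P₂ v ∨ Q₂ v) :=
  (hP.not.imp hQ).congr (fun _ => or_iff_not_imp_left) fun _ => or_iff_not_imp_left

theorem relabel (hP : JointDef P₁ P₂) (f : α → β) :
    JointDef (fun v => P₁ (v ∘ f)) (fun v => P₂ (v ∘ f)) := by
  obtain ⟨φ, hφ₁, hφ₂⟩ := hP
  exact ⟨φ.relabel f, fun v => by rw [Formula.realize_relabel, hφ₁],
    fun v => by rw [Formula.realize_relabel, hφ₂]⟩

theorem forall_tuple [Finite β] {R₁ : (α → G₁) → (β → G₁) → Prop}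
    {R₂ : (α → G₂) → (β → G₂) → Prop}
    (h : JointDef (α := α ⊕ β) (fun w => R₁ (w ∘ Sum.inl) (w ∘ Sum.inr))
      (fun w => R₂ (w ∘ Sum.inl) (w ∘ Sum.inr))) :
    JointDef (fun v => ∀ u, R₁ v u) (fun v => ∀ u, R₂ v u) := by
  obtain ⟨φ, hφ₁, hφ₂⟩ := h
  refine ⟨φ.iAlls β, fun v => ?_, fun v => ?_⟩
  · simp only [Formula.realize_iAlls, hφ₁]
    rfl
  · simp only [Formula.realize_iAlls, hφ₂]
    rfl

theorem exists_tuple [Finite β] {R₁ : (α → G₁) → (β → G₁) → Prop}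
    {R₂ : (α → G₂) → (β → G₂) → Prop}
    (h : JointDef (α := α ⊕ β) (fun w => R₁ (w ∘ Sum.inl) (w ∘ Sum.inr))
      (fun w => R₂ (w ∘ Sum.inl) (w ∘ Sum.inr))) :
    JointDef (fun v => ∃ u, R₁ v u) (fun v => ∃ u, R₂ v u) :=
  (forall_tuple (R₁ := fun v u => ¬ R₁ v u) (R₂ := fun v u => ¬ R₂ v u) h.not).not.congr
    (fun _ => by simp) fun _ => by simp

theorem all {R₁ : (α → G₁) → G₁ → Prop} {R₂ : (α → G₂) → G₂ → Prop}
    (h : JointDef (α := α ⊕ Unit) (fun w => R₁ (w ∘ Sum.inl) (w (.inr ())))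
      (fun w => R₂ (w ∘ Sum.inl) (w (.inr ())))) :
    JointDef (fun v => ∀ y, R₁ v y) (fun v => ∀ y, R₂ v y) :=
  (forall_tuple (R₁ := fun v u => R₁ v (u ())) (R₂ := fun v u => R₂ v (u ())) h).congr
    (fun _ => ⟨fun h u => h (u ()), fun h y => h fun _ => y⟩)
    fun _ => ⟨fun h u => h (u ()), fun h y => h fun _ => y⟩

theorem ex {R₁ : (α → G₁) → G₁ → Prop} {R₂ : (α → G₂) → G₂ → Prop}
    (h : JointDef (α := α ⊕ Unit) (fun w => R₁ (w ∘ Sum.inl) (w (.inr ())))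
      (fun w => R₂ (w ∘ Sum.inl) (w (.inr ())))) :
    JointDef (fun v => ∃ y, R₁ v y) (fun v => ∃ y, R₂ v y) :=
  (all (R₁ := fun v u => ¬ R₁ v u) (R₂ := fun v u => ¬ R₂ v u) h.not).not.congr
    (fun _ => by simp) fun _ => by simp

theorem forall_index {ι : Type*} [Finite ι] {R₁ : ι → (α → G₁) → Prop} {R₂ : ι → (α → G₂) → Prop}
    (h : ∀ i, JointDef (R₁ i) (R₂ i)) : JointDef (fun v => ∀ i, R₁ i v) (fun v => ∀ i, R₂ i v) := by
  choose φ hφ₁ hφ₂ using h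
  refine ⟨Formula.iInf φ, fun v => ?_, fun v => ?_⟩
  · simp only [Formula.realize_iInf, hφ₁]
  · simp only [Formula.realize_iInf, hφ₂]

theorem eq_var (a b : α) : JointDef (fun v : α → G₁ => v a = v b) (fun v : α → G₂ => v a = v b) :=
  ⟨(Term.var a).equal (Term.var b), fun v => by simp [Formula.realize_equal],
    fun v => by simp [Formula.realize_equal]⟩

theorem eq_mul_var (a b c : α) :
    JointDef (fun v : α → G₁ => v a = v b * v c) (fun v : α → G₂ => v a = v b * v c) :=
  ⟨(Term.var a).equal (Term.func (L := groupLang) GroupFunc.mul ![Term.var b, Term.var c]),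
    fun v => by rw [Formula.realize_equal]; rfl, fun v => by rw [Formula.realize_equal]; rfl⟩

/-- Substitution of definable functions in a definable predicate. -/
theorem subst [Finite β] {R₁ : (β → G₁) → Prop} {R₂ : (β → G₂) → Prop} (hR : JointDef R₁ R₂)
    {F₁ : β → (α → G₁) → G₁} {F₂ : β → (α → G₂) → G₂} (hF : ∀ b, JointFun (F₁ b) (F₂ b)) :
    JointDef (fun v => R₁ fun b => F₁ b v) (fun v => R₂ fun b => F₂ b v) := by
  refine (exists_tuple (β := β) (R₁ := fun v u => (∀ b, u b = F₁ b v) ∧ R₁ u)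
    (R₂ := fun v u => (∀ b, u b = F₂ b v) ∧ R₂ u)
    (and (forall_index fun b => ?_) (hR.relabel Sum.inr))).congr (fun v => ?_) fun v => ?_
  · exact (hF b).relabel (Sum.elim Sum.inl fun _ => Sum.inr b)
  · exact ⟨fun h => ⟨_, fun _ => rfl, h⟩, fun ⟨u, hu, h⟩ => by rwa [← funext hu]⟩
  · exact ⟨fun h => ⟨_, fun _ => rfl, h⟩, fun ⟨u, hu, h⟩ => by rwa [← funext hu]⟩

end JointDef

namespace JointFun

variable {F₁ H₁ : (α → G₁) → G₁} {F₂ H₂ : (α → G₂) → G₂}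

theorem var (a : α) : JointFun (fun v : α → G₁ => v a) (fun v : α → G₂ => v a) :=
  JointDef.eq_var (Sum.inr ()) (Sum.inl a)

theorem relabel (hF : JointFun F₁ F₂) (f : α → β) :
    JointFun (fun v => F₁ (v ∘ f)) (fun v => F₂ (v ∘ f)) :=
  JointDef.relabel hF (Sum.map f id)

theorem weaken (hF : JointFun F₁ F₂) :
    JointFun (fun v : α ⊕ β → G₁ => F₁ (v ∘ Sum.inl)) (fun v => F₂ (v ∘ Sum.inl)) :=
  hF.relabel Sum.inl

theorem eq (hF : JointFun F₁ F₂) (hH : JointFun H₁ H₂) :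
    JointDef (fun v => F₁ v = H₁ v) (fun v => F₂ v = H₂ v) :=
  (JointDef.eq_var (0 : Fin 2) 1).subst (F₁ := ![F₁, H₁]) (F₂ := ![F₂, H₂])
    (Fin.forall_fin_two.2 ⟨hF, hH⟩)

theorem mul (hF : JointFun F₁ F₂) (hH : JointFun H₁ H₂) :
    JointFun (fun v => F₁ v * H₁ v) (fun v => F₂ v * H₂ v) :=
  (JointDef.eq_mul_var (0 : Fin 3) 1 2).subst
    (F₁ := ![fun w : α ⊕ Unit → G₁ => w (Sum.inr ()), fun w => F₁ (w ∘ Sum.inl), fun w => H₁ (w ∘ Sum.inl)])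
    (F₂ := ![fun w : α ⊕ Unit → G₂ => w (Sum.inr ()), fun w => F₂ (w ∘ Sum.inl), fun w => H₂ (w ∘ Sum.inl)])
    (Fin.forall_fin_succ.2 ⟨var (Sum.inr ()), Fin.forall_fin_two.2 ⟨hF.weaken, hH.weaken⟩⟩)

/-- Multiplication is the only symbol of the language; the identity is definable as the unique
idempotent. -/
theorem one : JointFun (fun _ : α → G₁ => 1) (fun _ : α → G₂ => 1) :=
  (eq (mul (var (.inr ())) (var (.inr ()))) (var (.inr ()))).congr
    (fun _ => mul_eq_left.symm) fun _ => mul_eq_left.symm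

theorem inv (hF : JointFun F₁ F₂) : JointFun (fun v => (F₁ v)⁻¹) (fun v => (F₂ v)⁻¹) :=
  (eq (mul (var (.inr ())) hF.weaken) one).congr
    (fun _ => mul_eq_one_iff_eq_inv.symm) fun _ => mul_eq_one_iff_eq_inv.symm

theorem conj (hF : JointFun F₁ F₂) (hH : JointFun H₁ H₂) :
    JointFun (fun v => F₁ v * H₁ v * (F₁ v)⁻¹) (fun v => F₂ v * H₂ v * (F₂ v)⁻¹) :=
  (hF.mul hH).mul hF.inv

theorem commutator (hF : JointFun F₁ F₂) (hH : JointFun H₁ H₂) :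
    JointFun (fun v => ⁅F₁ v, H₁ v⁆) (fun v => ⁅F₂ v, H₂ v⁆) :=
  (hF.conj hH).mul hH.inv

theorem commute (hF : JointFun F₁ F₂) (hH : JointFun H₁ H₂) :
    JointDef (fun v => F₁ v * H₁ v = H₁ v * F₁ v) (fun v => F₂ v * H₂ v = H₂ v * F₂ v) :=
  (hF.mul hH).eq (hH.mul hF)

theorem ne_one (hF : JointFun F₁ F₂) : JointDef (fun v => F₁ v ≠ 1) (fun v => F₂ v ≠ 1) :=
  (hF.eq one).not

theorem disj (hF : JointFun F₁ F₂) (hH : JointFun H₁ H₂) :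
    JointDef (fun v => Disj (F₁ v) (H₁ v)) (fun v => Disj (F₂ v) (H₂ v)) := by
  -- Each `Unit` summand is one quantified variable of `Disj`: from the outermost quantifier inwards
  -- `h`, `f₁`, `f₂`.
  have hc : JointFun
      (fun v : ((α ⊕ Unit) ⊕ Unit) ⊕ Unit → G₁ => ⁅v (.inl (.inr ())),
        ⁅v (.inr ()), v (.inl (.inl (.inr ())))⁆⁆)
      (fun v : ((α ⊕ Unit) ⊕ Unit) ⊕ Unit → G₂ => ⁅v (.inl (.inr ())),
        ⁅v (.inr ()), v (.inl (.inl (.inr ())))⁆⁆) :=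
    (var _).commutator ((var _).commutator (var _))
  exact .all (.imp (hF.weaken.commute (var _)).not (.ex (.ex (.and
    ((var (.inl (.inr ()))).commute hH.weaken.weaken.weaken)
    (.and ((var (.inr ())).commute hH.weaken.weaken.weaken)
      (.and hc.ne_one (hc.commute hH.weaken.weaken.weaken)))))))

theorem sep (hF : JointFun F₁ F₂) (hH : JointFun H₁ H₂) :
    JointDef (fun v => Sep (F₁ v) (H₁ v)) (fun v => Sep (F₂ v) (H₂ v)) :=
  .and hF.ne_one (.and hH.ne_one (.not (.ex (.and
    (((var (.inr ())).conj hF.weaken).disj hH.weaken).not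
    (((var (.inr ())).conj hH.weaken).disj hF.weaken).not))))

theorem dir {F₁' H₁' : (α → G₁) → G₁} {F₂' H₂' : (α → G₂) → G₂} (hF : JointFun F₁ F₂)
    (hH : JointFun H₁ H₂) (hF' : JointFun F₁' F₂') (hH' : JointFun H₁' H₂') :
    JointDef (fun v => Dir (F₁ v) (H₁ v) (F₁' v) (H₁' v))
      (fun v => Dir (F₂ v) (H₂ v) (F₂' v) (H₂' v)) :=
  .and (hF.sep hH) (.and (hF'.sep hH') (.ex (.and
    (((var (.inr ())).conj hF.weaken).disj hF'.weaken).not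
    (((var (.inr ())).conj hH.weaken).disj hH'.weaken).not)))

end JointFun

/-- Coordinatewise joint definability of triples. -/
def JointTriple (T₁ : (α → G₁) → Fin 3 → G₁) (T₂ : (α → G₂) → Fin 3 → G₂) : Prop :=
  ∀ j, JointFun (fun v => T₁ v j) (fun v => T₂ v j)

namespace JointTriple

variable {T₁ U₁ V₁ W₁ : (α → G₁) → Fin 3 → G₁} {T₂ U₂ V₂ W₂ : (α → G₂) → Fin 3 → G₂}
  {F₁ H₁ K₁ : (α → G₁) → G₁} {F₂ H₂ K₂ : (α → G₂) → G₂}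

theorem var (i : Fin 3 → α) :
    JointTriple (fun (v : α → G₁) j => v (i j)) (fun (v : α → G₂) j => v (i j)) :=
  fun j => .var (i j)

theorem weaken (hT : JointTriple T₁ T₂) :
    JointTriple (fun v : α ⊕ β → G₁ => T₁ (v ∘ Sum.inl)) (fun v => T₂ (v ∘ Sum.inl)) :=
  fun j => (hT j).weaken

theorem conjTriple (hF : JointFun F₁ F₂) (hT : JointTriple T₁ T₂) :
    JointTriple (fun v => conjTriple (F₁ v) (T₁ v)) (fun v => conjTriple (F₂ v) (T₂ v)) :=
  Fin.forall_fin_succ.2 ⟨hF.conj (hT 0), Fin.forall_fin_two.2 ⟨hT 1, hT 2⟩⟩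

theorem valid (hT : JointTriple T₁ T₂) :
    JointDef (fun v => Valid (T₁ v)) (fun v => Valid (T₂ v)) :=
  .ex ((hT 1).weaken.dir (hT 2).weaken (hT 0).weaken (.var _))

theorem after (hF : JointFun F₁ F₂) (hH : JointFun H₁ H₂) (hT : JointTriple T₁ T₂)
    (hK : JointFun K₁ K₂) : JointDef (fun v => After (F₁ v) (H₁ v) (T₁ v) (K₁ v))
      (fun v => After (F₂ v) (H₂ v) (T₂ v) (K₂ v)) :=
  .or (.and (hF.dir hH (hT 1) (hT 2)) ((hT 1).dir (hT 2) (hT 0) hK))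
    (.and (hF.dir hH (hT 2) (hT 1)) (.and hK.ne_one (.all (.imp
      ((hT 1).weaken.dir (hT 2).weaken (hT 0).weaken (.var _))
      ((hT 1).weaken.dir (hT 2).weaken hK.weaken (.var _))))))

theorem pointLt (hF : JointFun F₁ F₂) (hH : JointFun H₁ H₂) (hT : JointTriple T₁ T₂)
    (hU : JointTriple U₁ U₂) : JointDef (fun v => PointLt (F₁ v) (H₁ v) (T₁ v) (U₁ v))
      (fun v => PointLt (F₂ v) (H₂ v) (T₂ v) (U₂ v)) :=
  .ex (.and (after hF.weaken hH.weaken hT.weaken (.var _))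
    (after hH.weaken hF.weaken hU.weaken (.var _)))

theorem pointEq (hT : JointTriple T₁ T₂) (hU : JointTriple U₁ U₂) :
    JointDef (fun v => PointEq (T₁ v) (U₁ v)) (fun v => PointEq (T₂ v) (U₂ v)) :=
  .and hT.valid (.and hU.valid (.not (.ex (.ex (.and
    ((JointFun.var (Sum.inl (Sum.inr ()))).sep (.var (Sum.inr ())))
    (pointLt (.var (Sum.inl (Sum.inr ()))) (.var (Sum.inr ())) hT.weaken.weaken hU.weaken.weaken))))))

theorem pointEd (hT : JointTriple T₁ T₂) (hU : JointTriple U₁ U₂) (hV : JointTriple V₁ V₂)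
    (hW : JointTriple W₁ W₂) : JointDef (fun v => PointEd (T₁ v) (U₁ v) (V₁ v) (W₁ v))
      (fun v => PointEd (T₂ v) (U₂ v) (V₂ v) (W₂ v)) :=
  .and hT.valid (.and hU.valid (.and hV.valid (.and hW.valid (.ex (.ex (.and
    ((JointFun.var (Sum.inl (Sum.inr ()))).sep (.var (Sum.inr ())))
    (.and (pointLt (.var (Sum.inl (Sum.inr ()))) (.var (Sum.inr ())) hT.weaken.weaken hU.weaken.weaken)
      (pointLt (.var (Sum.inl (Sum.inr ()))) (.var (Sum.inr ())) hV.weaken.weaken hW.weaken.weaken))))))))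

end JointTriple

end

end LinearPermGroup

/-! ### Interpretations by common formulas transfer elementary equivalence. -/

namespace LinearPermGroup

open FirstOrder FirstOrder.Language

namespace JointInterp

variable {γ : Type}

theorem exists_tuple {G M : Type*} {D : (γ → G) → M} (hD : Function.Surjective D)
    {n : ℕ} (m : Fin n → M) : ∃ u : Fin n × γ → G, ∀ i, D (fun j => u (i, j)) = m i :=
  ⟨fun p => (hD (m p.1)).choose p.2, fun i => (hD (m i)).choose_spec⟩

theorem elim_comp {G M : Type*} (D : (γ → G) → M) {δ : Type} {n : ℕ}
    (w : (δ ⊕ Fin n) × γ → G) : (fun d => D fun j => w (d, j)) =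
      Sum.elim (fun d => D fun j => w (Sum.inl d, j)) fun i => D fun j => w (Sum.inr i, j) :=
  (Sum.elim_comp_inl_inr fun d => D fun j => w (d, j)).symm

/-- The indices of the tuples for one more quantified variable. -/
def snocIndex {δ : Type} {n : ℕ} : (δ ⊕ Fin (n + 1)) × γ → ((δ ⊕ Fin n) × γ) ⊕ γ
  | (Sum.inl d, j) => Sum.inl (Sum.inl d, j)
  | (Sum.inr i, j) => Fin.lastCases (motive := fun _ => ((δ ⊕ Fin n) × γ) ⊕ γ) (Sum.inr j)
      (fun i => Sum.inl (Sum.inr i, j)) i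

theorem snoc_eq {G M : Type*} (D : (γ → G) → M) {δ : Type} {n : ℕ}
    (w : ((δ ⊕ Fin n) × γ) ⊕ γ → G) :
    (fun i => D fun j => (w ∘ snocIndex) (Sum.inr i, j)) =
      Fin.snoc (α := fun _ => M) (fun i => D fun j => w (Sum.inl (Sum.inr i, j)))
        (D (w ∘ Sum.inr)) := by
  funext i
  refine Fin.lastCases ?_ (fun i => ?_) i
  · rw [Fin.snoc_last]
    congr 1
    funext j
    simp [snocIndex]
  · rw [Fin.snoc_castSucc]
    congr 1
    funext j
    simp [snocIndex]

end JointInterp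

section

variable {G₁ G₂ M₁ M₂ : Type*} [Group G₁] [Group G₂] {L : FirstOrder.Language.{0, 0}} [L.Structure M₁]
  [L.Structure M₂] {γ : Type} [Finite γ]

/-- An interpretation of a structure in a group and of a structure in another group by the same
formulas: the elements of the structures are denoted by tuples of group elements. -/
structure JointInterp (L : FirstOrder.Language.{0, 0}) [L.Structure M₁] [L.Structure M₂]
    (D₁ : (γ → G₁) → M₁) (D₂ : (γ → G₂) → M₂) : Prop where
  surj₁ : Function.Surjective D₁
  surj₂ : Function.Surjective D₂
  eq : JointDef (α := γ ⊕ γ) (fun w => D₁ (w ∘ Sum.inl) = D₁ (w ∘ Sum.inr))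
    (fun w => D₂ (w ∘ Sum.inl) = D₂ (w ∘ Sum.inr))
  func : ∀ {n : ℕ} (f : L.Functions n), JointDef (α := (Fin n × γ) ⊕ γ)
    (fun w => D₁ (w ∘ Sum.inr) = Structure.funMap f fun i => D₁ fun j => w (Sum.inl (i, j)))
    (fun w => D₂ (w ∘ Sum.inr) = Structure.funMap f fun i => D₂ fun j => w (Sum.inl (i, j)))
  rel : ∀ {n : ℕ} (r : L.Relations n), JointDef (α := Fin n × γ)
    (fun w => Structure.RelMap r fun i => D₁ fun j => w (i, j))
    (fun w => Structure.RelMap r fun i => D₂ fun j => w (i, j))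

namespace JointInterp

variable {D₁ : (γ → G₁) → M₁} {D₂ : (γ → G₂) → M₂}

/-- Nested terms are unravelled by naming the value of every immediate subterm with a tuple, which
exists by surjectivity. -/
theorem term (h : JointInterp L D₁ D₂) {δ : Type} (t : L.Term δ) :
    JointDef (α := (δ × γ) ⊕ γ)
      (fun w => D₁ (w ∘ Sum.inr) = t.realize fun d => D₁ fun j => w (Sum.inl (d, j)))
      (fun w => D₂ (w ∘ Sum.inr) = t.realize fun d => D₂ fun j => w (Sum.inl (d, j))) := by
  induction t with
  | var d => exact h.eq.relabel (Sum.elim Sum.inr fun j => Sum.inl (d, j))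
  | @func n f ts ih =>
    refine (JointDef.exists_tuple (β := Fin n × γ)
      (R₁ := fun w u => (∀ i, D₁ (fun j => u (i, j)) =
        (ts i).realize fun d => D₁ fun j => w (Sum.inl (d, j))) ∧
        D₁ (w ∘ Sum.inr) = Structure.funMap f fun i => D₁ fun j => u (i, j))
      (R₂ := fun w u => (∀ i, D₂ (fun j => u (i, j)) =
        (ts i).realize fun d => D₂ fun j => w (Sum.inl (d, j))) ∧
        D₂ (w ∘ Sum.inr) = Structure.funMap f fun i => D₂ fun j => u (i, j))
      (.and (.forall_index fun i => ?_) ?_)).congr (fun w => ?_) fun w => ?_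
    · exact (ih i).relabel (Sum.elim (fun p => Sum.inl (Sum.inl p)) fun j => Sum.inr (i, j))
    · exact (h.func f).relabel (Sum.elim Sum.inr fun j => Sum.inl (Sum.inr j))
    · constructor
      · intro hw
        obtain ⟨u, hu⟩ := exists_tuple h.surj₁
          fun i => (ts i).realize fun d => D₁ fun j => w (Sum.inl (d, j))
        refine ⟨u, hu, hw.trans ?_⟩
        simp only [hu, Term.realize_func]
      · rintro ⟨u, hu, hw⟩
        simp only [hu] at hw
        exact hw
    · constructor
      · intro hw
        obtain ⟨u, hu⟩ := exists_tuple h.surj₂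
          fun i => (ts i).realize fun d => D₂ fun j => w (Sum.inl (d, j))
        refine ⟨u, hu, hw.trans ?_⟩
        simp only [hu, Term.realize_func]
      · rintro ⟨u, hu, hw⟩
        simp only [hu] at hw
        exact hw

/-- A quantifier over the structure turns into a quantifier over tuples of group elements, because
every element of the structure is denoted by a tuple. -/
theorem formula (h : JointInterp L D₁ D₂) {δ : Type} {n : ℕ} (φ : L.BoundedFormula δ n) :
    JointDef (α := (δ ⊕ Fin n) × γ)
      (fun w => φ.Realize (fun d => D₁ fun j => w (Sum.inl d, j))
        fun i => D₁ fun j => w (Sum.inr i, j))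
      (fun w => φ.Realize (fun d => D₂ fun j => w (Sum.inl d, j))
        fun i => D₂ fun j => w (Sum.inr i, j)) := by
  induction φ with
  | falsum => exact .false
  | @equal n t₁ t₂ =>
    refine (JointDef.exists_tuple (β := γ)
      (R₁ := fun w u => (D₁ u = t₁.realize fun d => D₁ fun j => w (d, j)) ∧
        D₁ u = t₂.realize fun d => D₁ fun j => w (d, j))
      (R₂ := fun w u => (D₂ u = t₁.realize fun d => D₂ fun j => w (d, j)) ∧
        D₂ u = t₂.realize fun d => D₂ fun j => w (d, j))
      (.and (h.term t₁) (h.term t₂))).congr (fun w => ?_) fun w => ?_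
    · rw [← Term.bdEqual, BoundedFormula.realize_bdEqual, ← elim_comp]
      obtain ⟨u, hu⟩ := h.surj₁ (t₁.realize fun d => D₁ fun j => w (d, j))
      exact ⟨fun he => ⟨u, hu, hu.trans he⟩, fun ⟨u, h1, h2⟩ => h1.symm.trans h2⟩
    · rw [← Term.bdEqual, BoundedFormula.realize_bdEqual, ← elim_comp]
      obtain ⟨u, hu⟩ := h.surj₂ (t₁.realize fun d => D₂ fun j => w (d, j))
      exact ⟨fun he => ⟨u, hu, hu.trans he⟩, fun ⟨u, h1, h2⟩ => h1.symm.trans h2⟩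
  | @rel n l r ts =>
    refine (JointDef.exists_tuple (β := Fin l × γ)
      (R₁ := fun w u => (∀ i, D₁ (fun j => u (i, j)) =
        (ts i).realize fun d => D₁ fun j => w (d, j)) ∧
        Structure.RelMap r fun i => D₁ fun j => u (i, j))
      (R₂ := fun w u => (∀ i, D₂ (fun j => u (i, j)) =
        (ts i).realize fun d => D₂ fun j => w (d, j)) ∧
        Structure.RelMap r fun i => D₂ fun j => u (i, j))
      (.and (.forall_index fun i => ?_) ((h.rel r).relabel Sum.inr))).congr
        (fun w => ?_) fun w => ?_
    · exact (h.term (ts i)).relabel (Sum.map id fun j => (i, j))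
    · rw [← Relations.boundedFormula, BoundedFormula.realize_rel, ← elim_comp]
      constructor
      · intro hw
        obtain ⟨u, hu⟩ := exists_tuple h.surj₁ fun i => (ts i).realize fun d => D₁ fun j => w (d, j)
        exact ⟨u, hu, by simpa only [hu] using hw⟩
      · rintro ⟨u, hu, hw⟩
        simpa only [hu] using hw
    · rw [← Relations.boundedFormula, BoundedFormula.realize_rel, ← elim_comp]
      constructor
      · intro hw
        obtain ⟨u, hu⟩ := exists_tuple h.surj₂ fun i => (ts i).realize fun d => D₂ fun j => w (d, j)
        exact ⟨u, hu, by simpa only [hu] using hw⟩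
      · rintro ⟨u, hu, hw⟩
        simpa only [hu] using hw
  | imp _ _ ih₁ ih₂ => exact ih₁.imp ih₂
  | @all n φ ih =>
    refine (JointDef.forall_tuple (β := γ)
      (R₁ := fun w u => φ.Realize (fun d => D₁ fun j => w (Sum.inl d, j))
        (Fin.snoc (fun i => D₁ fun j => w (Sum.inr i, j)) (D₁ u)))
      (R₂ := fun w u => φ.Realize (fun d => D₂ fun j => w (Sum.inl d, j))
        (Fin.snoc (fun i => D₂ fun j => w (Sum.inr i, j)) (D₂ u)))
      ((ih.relabel snocIndex).congr (fun w => ?_) fun w => ?_)).congr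
        (fun w => ?_) fun w => ?_
    · rw [snoc_eq]; rfl
    · rw [snoc_eq]; rfl
    · rw [BoundedFormula.realize_all, h.surj₁.forall]
    · rw [BoundedFormula.realize_all, h.surj₂.forall]

theorem elementarilyEquivalent (h : JointInterp L D₁ D₂)
    (he : groupLang.ElementarilyEquivalent G₁ G₂) : L.ElementarilyEquivalent M₁ M₂ := by
  rw [elementarilyEquivalent_iff]
  intro φ
  obtain ⟨ψ, h₁, h₂⟩ := h.formula φ
  -- The index type `(Empty ⊕ Fin 0) × γ` is empty, so the translated formula can be relabelled to a
  -- sentence.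
  have hs := elementarilyEquivalent_iff.1 he
    (ψ.relabel fun p => p.1.elim (fun e => e) fun i => i.elim0)
  have e₁ := h₁ ((default : Empty → G₁) ∘ fun p => p.1.elim (fun e => e) fun i => i.elim0)
  have e₂ := h₂ ((default : Empty → G₂) ∘ fun p => p.1.elim (fun e => e) fun i => i.elim0)
  rw [← Formula.realize_relabel] at e₁ e₂
  have f₁ : Sentence.Realize M₁ φ ↔ _ := (iff_of_eq (congrArg₂ (BoundedFormula.Realize φ)
    (Subsingleton.elim _ _) (Subsingleton.elim _ _))).trans e₁.symm
  have f₂ : Sentence.Realize M₂ φ ↔ _ := (iff_of_eq (congrArg₂ (BoundedFormula.Realize φ)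
    (Subsingleton.elim _ _) (Subsingleton.elim _ _))).trans e₂.symm
  exact f₁.trans (hs.trans f₂.symm)

end JointInterp

end

end LinearPermGroup

/-! ### The action structure interpreted in the group. -/

namespace LinearPermGroup

open FirstOrder FirstOrder.Language DedekindCompletion

section

variable {L : Type*} [LinearOrder L]

open Classical in
/-- The point or the group element denoted by a triple of group elements. -/
noncomputable def denote (G : Subgroup (L ≃o L)) (t : Fin 3 → G) : ACT (Ep G) G :=
  if h : ∃ x : Ep G, IsPt t (x : DedekindCompletion L) then .point h.choose else .elt (t 0)

theorem ChainAction.denote_of_isPt {G : Subgroup (L ≃o L)}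
    (h : ChainAction (DedekindCompletion L) G) {t : Fin 3 → G} {x : Ep G}
    (ht : IsPt t (x : DedekindCompletion L)) : denote G t = .point x := by
  have he : ∃ x : Ep G, IsPt t (x : DedekindCompletion L) := ⟨x, ht⟩
  rw [denote, dif_pos he]
  congr 1
  exact Subtype.ext (h.isPt_unique he.choose_spec ht)

variable [DenselyOrdered L] [NoMinOrder L] [NoMaxOrder L]

theorem IsPt.mem_Ep {G : Subgroup (L ≃o L)} {t : Fin 3 → G} {x : DedekindCompletion L}
    (h : IsPt t x) : x ∈ Ep G :=
  mem_Ep_iff.2 ⟨t 0, (t 0).2, h.imp And.right And.right⟩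

namespace ChainAction

variable {G : Subgroup (L ≃o L)}

theorem valid_iff (h : ChainAction (DedekindCompletion L) G) {t : Fin 3 → G} :
    Valid t ↔ ∃ x : Ep G, IsPt t (x : DedekindCompletion L) := by
  refine ⟨fun ht => ?_, fun ⟨_, hx⟩ => h.valid_of_isPt hx⟩
  obtain ⟨x, hx⟩ := h.exists_isPt_of_valid exists_isLUB exists_isGLB ht
  exact ⟨⟨x, hx.mem_Ep⟩, hx⟩

theorem denote_of_not_valid (h : ChainAction (DedekindCompletion L) G) {t : Fin 3 → G}
    (ht : ¬ Valid t) : denote G t = .elt (t 0) :=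
  dif_neg fun hc => ht (h.valid_iff.2 hc)

theorem isPoint_denote_iff (h : ChainAction (DedekindCompletion L) G) {t : Fin 3 → G} :
    ACT.IsPoint (denote G t) ↔ Valid t := by
  by_cases ht : Valid t
  · obtain ⟨x, hx⟩ := h.valid_iff.1 ht
    rw [h.denote_of_isPt hx]
    simp [ACT.IsPoint, ht]
  · rw [h.denote_of_not_valid ht]
    simp [ACT.IsPoint, ht]

theorem isGroup_denote_iff (h : ChainAction (DedekindCompletion L) G) {t : Fin 3 → G} :
    ACT.IsGroup (denote G t) ↔ ¬ Valid t := by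
  by_cases ht : Valid t
  · obtain ⟨x, hx⟩ := h.valid_iff.1 ht
    rw [h.denote_of_isPt hx]
    simp [ACT.IsGroup, ht]
  · rw [h.denote_of_not_valid ht]
    simp [ACT.IsGroup, ht]

/-- The second alternative is the region outside the domain, where the operation returns its first
argument. -/
theorem mul_denote_iff (h : ChainAction (DedekindCompletion L) G) {t t₁ t₂ : Fin 3 → G} :
    denote G t = ACT.mul (denote G t₁) (denote G t₂) ↔
      (¬ Valid t₁ ∧ ¬ Valid t₂ ∧ ¬ Valid t ∧ t 0 = t₁ 0 * t₂ 0) ∨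
        ((Valid t₁ ∨ Valid t₂) ∧ denote G t = denote G t₁) := by
  by_cases h₁ : Valid t₁
  · obtain ⟨x, hx⟩ := h.valid_iff.1 h₁
    rw [h.denote_of_isPt hx]
    simp [ACT.mul, h₁]
  · rw [h.denote_of_not_valid h₁]
    by_cases h₂ : Valid t₂
    · obtain ⟨x, hx⟩ := h.valid_iff.1 h₂
      rw [h.denote_of_isPt hx]
      simp [ACT.mul, h₂]
    · rw [h.denote_of_not_valid h₂]
      by_cases ht : Valid t
      · obtain ⟨x, hx⟩ := h.valid_iff.1 ht
        rw [h.denote_of_isPt hx]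
        simp [ACT.mul, h₁, h₂, ht]
      · rw [h.denote_of_not_valid ht]
        simp [ACT.mul, h₁, h₂, ht]

theorem ap_denote_iff (h : ChainAction (DedekindCompletion L) G) {t t₁ t₂ : Fin 3 → G} :
    denote G t = ACT.ap (denote G t₁) (denote G t₂) ↔
      (¬ Valid t₁ ∧ Valid t₂ ∧ denote G t = denote G (conjTriple (t₁ 0) t₂)) ∨
        ((Valid t₁ ∨ ¬ Valid t₂) ∧ denote G t = denote G t₁) := by
  by_cases h₁ : Valid t₁
  · obtain ⟨x, hx⟩ := h.valid_iff.1 h₁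
    rw [h.denote_of_isPt hx]
    simp [ACT.ap, h₁]
  · rw [h.denote_of_not_valid h₁]
    by_cases h₂ : Valid t₂
    · obtain ⟨x, hx⟩ := h.valid_iff.1 h₂
      have hc : denote G (conjTriple (t₁ 0) t₂) = .point (t₁ 0 • x) :=
        h.denote_of_isPt (h.isPt_conjTriple (t₁ 0) hx)
      rw [h.denote_of_isPt hx, hc]
      simp [ACT.ap, h₁, h₂]
    · rw [h.denote_of_not_valid h₂]
      simp [ACT.ap, h₁, h₂]

variable [Nonempty L]

theorem denote_surjective (h : ChainAction (DedekindCompletion L) G) :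
    Function.Surjective (denote G) := by
  rintro (x | g)
  · obtain ⟨p, q, hpq⟩ := h.exists_before
    obtain ⟨g, hg, hx | hx⟩ := mem_Ep_iff.1 x.2
    · exact ⟨![⟨g, hg⟩, p, q], h.denote_of_isPt (.inl ⟨hpq, hx⟩)⟩
    · exact ⟨![⟨g, hg⟩, q, p], h.denote_of_isPt (.inr ⟨hpq, hx⟩)⟩
  -- The identity is separated from nothing, so this triple names no point and stands for `g`.
  · exact ⟨![g, 1, 1], h.denote_of_not_valid fun ⟨_, hf⟩ => hf.1.1 rfl⟩

theorem denote_eq_iff (h : ChainAction (DedekindCompletion L) G) {t t' : Fin 3 → G} :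
    denote G t = denote G t' ↔ PointEq t t' ∨ (¬ Valid t ∧ ¬ Valid t' ∧ t 0 = t' 0) := by
  by_cases ht : Valid t
  · obtain ⟨x, hx⟩ := h.valid_iff.1 ht
    rw [h.denote_of_isPt hx]
    by_cases ht' : Valid t'
    · obtain ⟨y, hy⟩ := h.valid_iff.1 ht'
      rw [h.denote_of_isPt hy, h.pointEq_iff hx hy, ACT.point.injEq, Subtype.ext_iff]
      simp [ht]
    · rw [h.denote_of_not_valid ht']
      simp [PointEq, ht, ht']
  · rw [h.denote_of_not_valid ht]
    by_cases ht' : Valid t'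
    · obtain ⟨y, hy⟩ := h.valid_iff.1 ht'
      rw [h.denote_of_isPt hy]
      simp [PointEq, ht, ht']
    · rw [h.denote_of_not_valid ht', ACT.elt.injEq]
      simp [PointEq, ht, ht']

theorem ed_denote_iff (h : ChainAction (DedekindCompletion L) G) {t₁ t₂ t₃ t₄ : Fin 3 → G} :
    (∃ x₁ x₂ y₁ y₂ : Ep G, denote G t₁ = .point x₁ ∧ denote G t₂ = .point x₂ ∧
      denote G t₃ = .point y₁ ∧ denote G t₄ = .point y₂ ∧ Ed x₁ x₂ y₁ y₂) ↔
      PointEd t₁ t₂ t₃ t₄ := by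
  have key : ∀ {t : Fin 3 → G} {x : Ep G}, denote G t = .point x →
      IsPt t (x : DedekindCompletion L) := by
    intro t x ht
    obtain ⟨y, hy⟩ := h.valid_iff.1 (h.isPoint_denote_iff.1 ⟨x, ht⟩)
    rw [h.denote_of_isPt hy, ACT.point.injEq] at ht
    exact ht ▸ hy
  constructor
  · rintro ⟨x₁, x₂, y₁, y₂, h₁, h₂, h₃, h₄, he⟩
    exact (h.pointEd_iff (key h₁) (key h₂) (key h₃) (key h₄)).2 he
  · intro he
    obtain ⟨x₁, h₁⟩ := h.valid_iff.1 he.1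
    obtain ⟨x₂, h₂⟩ := h.valid_iff.1 he.2.1
    obtain ⟨x₃, h₃⟩ := h.valid_iff.1 he.2.2.1
    obtain ⟨x₄, h₄⟩ := h.valid_iff.1 he.2.2.2.1
    exact ⟨x₁, x₂, x₃, x₄, h.denote_of_isPt h₁, h.denote_of_isPt h₂, h.denote_of_isPt h₃,
      h.denote_of_isPt h₄, (h.pointEd_iff h₁ h₂ h₃ h₄).1 he⟩

end ChainAction

end

section

variable {L₁ L₂ : Type*} [LinearOrder L₁] [DenselyOrdered L₁] [NoMinOrder L₁] [NoMaxOrder L₁]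
  [Nonempty L₁] [LinearOrder L₂] [DenselyOrdered L₂] [NoMinOrder L₂] [NoMaxOrder L₂] [Nonempty L₂]
  {G₁ : Subgroup (L₁ ≃o L₁)} {G₂ : Subgroup (L₂ ≃o L₂)}

theorem jointDef_denote_eq (h₁ : ChainAction (DedekindCompletion L₁) G₁)
    (h₂ : ChainAction (DedekindCompletion L₂) G₂) {α : Type}
    {T₁ U₁ : (α → G₁) → Fin 3 → G₁} {T₂ U₂ : (α → G₂) → Fin 3 → G₂}
    (hT : JointTriple T₁ T₂) (hU : JointTriple U₁ U₂) :
    JointDef (fun v => denote G₁ (T₁ v) = denote G₁ (U₁ v))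
      (fun v => denote G₂ (T₂ v) = denote G₂ (U₂ v)) :=
  (JointDef.or (hT.pointEq hU) (.and hT.valid.not (.and hU.valid.not ((hT 0).eq (hU 0))))).congr
    (fun _ => h₁.denote_eq_iff) fun _ => h₂.denote_eq_iff

theorem jointInterp_denote (h₁ : ChainAction (DedekindCompletion L₁) G₁)
    (h₂ : ChainAction (DedekindCompletion L₂) G₂) :
    JointInterp actLang (denote G₁) (denote G₂) where
  surj₁ := h₁.denote_surjective
  surj₂ := h₂.denote_surjective
  eq := jointDef_denote_eq h₁ h₂ (.var Sum.inl) (.var Sum.inr)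
  func {n} f := by
    have T : JointTriple (α := (Fin 2 × Fin 3) ⊕ Fin 3) (fun (v : _ → G₁) j => v (Sum.inr j))
      (fun (v : _ → G₂) j => v (Sum.inr j)) := .var Sum.inr
    have U : ∀ i, JointTriple (α := (Fin 2 × Fin 3) ⊕ Fin 3)
      (fun (v : _ → G₁) j => v (Sum.inl (i, j))) (fun (v : _ → G₂) j => v (Sum.inl (i, j))) :=
      fun i => .var fun j => Sum.inl (i, j)
    cases f with
    | mul =>
      exact (JointDef.or (.and (U 0).valid.not (.and (U 1).valid.not (.and T.valid.not
        ((T 0).eq ((U 0 0).mul (U 1 0)))))) (.and (.or (U 0).valid (U 1).valid)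
        (jointDef_denote_eq h₁ h₂ T (U 0)))).congr
        (fun _ => h₁.mul_denote_iff) fun _ => h₂.mul_denote_iff
    | ap =>
      exact (JointDef.or (.and (U 0).valid.not (.and (U 1).valid
        (jointDef_denote_eq h₁ h₂ T (.conjTriple (U 0 0) (U 1)))))
        (.and (.or (U 0).valid (U 1).valid.not) (jointDef_denote_eq h₁ h₂ T (U 0)))).congr
        (fun _ => h₁.ap_denote_iff) fun _ => h₂.ap_denote_iff
  rel {n} r := by
    have U : ∀ {n : ℕ} (i : Fin n), JointTriple (α := Fin n × Fin 3)
      (fun (v : _ → G₁) j => v (i, j)) (fun (v : _ → G₂) j => v (i, j)) :=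
      fun i => .var fun j => (i, j)
    cases r with
    | ed =>
      exact ((U 0).pointEd (U 1) (U 2) (U 3)).congr
        (fun _ => h₁.ed_denote_iff) fun _ => h₂.ed_denote_iff
    | isPoint =>
      exact (U 0).valid.congr (fun _ => h₁.isPoint_denote_iff) fun _ => h₂.isPoint_denote_iff
    | isGroup =>
      exact (U 0).valid.not.congr (fun _ => h₁.isGroup_denote_iff) fun _ => h₂.isGroup_denote_iff
    | mulDom =>
      exact ((U 0).valid.not.and (U 1).valid.not).congr
        (fun _ => and_congr h₁.isGroup_denote_iff h₁.isGroup_denote_iff)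
        fun _ => and_congr h₂.isGroup_denote_iff h₂.isGroup_denote_iff
    | apDom =>
      exact ((U 0).valid.not.and (U 1).valid).congr
        (fun _ => and_congr h₁.isGroup_denote_iff h₁.isPoint_denote_iff)
        fun _ => and_congr h₂.isGroup_denote_iff h₂.isPoint_denote_iff

end

end LinearPermGroup

/-! ### Reconstruction of the completed chain from a group isomorphism. -/

namespace LinearPermGroup

open FirstOrder FirstOrder.Language DedekindCompletion

open scoped commutatorElement

section

variable {G₁ G₂ : Type*} [Group G₁] [Group G₂] (α : G₁ ≃* G₂)

theorem disj_map_iff {f g : G₁} : Disj (α f) (α g) ↔ Disj f g := by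
  simp only [Disj, α.surjective.forall, α.surjective.exists, ← map_commutatorElement, ← map_mul,
    α.injective.eq_iff, ne_eq, EmbeddingLike.map_eq_one_iff]

theorem sep_map_iff {f g : G₁} : Sep (α f) (α g) ↔ Sep f g := by
  simp only [Sep, α.surjective.exists, ← map_mul, ← map_inv, disj_map_iff, ne_eq,
    EmbeddingLike.map_eq_one_iff]

theorem dir_map_iff {f₁ f₂ g₁ g₂ : G₁} :
    Dir (α f₁) (α f₂) (α g₁) (α g₂) ↔ Dir f₁ f₂ g₁ g₂ := by
  simp only [Dir, α.surjective.exists, ← map_mul, ← map_inv, disj_map_iff, sep_map_iff]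

end

/-- The element `f` is nontrivial with support bounded above by `x`. -/
def Below {X G : Type*} [LinearOrder X] [Group G] [MulAction G X] (x : X) (f : G) : Prop :=
  f ≠ 1 ∧ ∀ y : X, f • y ≠ y → y ≤ x

/-- The points `x` and `z` of two chains determine corresponding sets of group elements. -/
def Matches {X₁ X₂ G₁ G₂ : Type*} [LinearOrder X₁] [LinearOrder X₂] [Group G₁] [Group G₂]
    [MulAction G₁ X₁] [MulAction G₂ X₂] (α : G₁ ≃* G₂) (x : X₁) (z : X₂) : Prop :=
  ∀ f, Below x f ↔ Below z (α f)

namespace ChainAction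

section

variable {X G : Type*} [LinearOrder X] [Group G] [MulAction G X]

/-- A point is recovered from the elements supported below it: if `y < x`, an element supported
between them tells the two apart. -/
theorem le_iff_below (h : ChainAction X G) {x y : X} :
    x ≤ y ↔ ∀ f : G, Below x f → Below y f := by
  refine ⟨fun hxy f hf => ⟨hf.1, fun z hz => (hf.2 z hz).trans hxy⟩, fun hb => ?_⟩
  by_contra! hlt
  obtain ⟨f, hf, hs⟩ := h.moving hlt
  obtain ⟨z, hz⟩ := h.exists_ne hf
  exact ((hb f ⟨hf, fun z hz => (hs z hz).2.le⟩).2 z hz).not_gt (hs z hz).1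

theorem below_smul_iff (h : ChainAction X G) {x : X} {g f : G} :
    Below (g • x) f ↔ Below x (g⁻¹ * f * g) := by
  have hf : f = g * (g⁻¹ * f * g) * g⁻¹ := by group
  refine and_congr (not_congr ?_) ?_
  · nth_rw 1 [hf]
    exact conj_eq_one_iff
  · rw [(MulAction.surjective g).forall]
    refine forall_congr' fun y => ?_
    nth_rw 1 [hf]
    rw [conj_smul_ne, h.smul_le_iff]

/-- A bijection commuting with the action maps each support onto itself. An increasing one with `σ x
≠ x` would push a support lying between `x` and `σ x` out of that interval, and a decreasing one
would interchange the order of two separated supports. -/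
theorem eq_self_of_commute [DenselyOrdered X] [NoMaxOrder X] (h : ChainAction X G) (σ : X ≃ X)
    (hσ : StrictMono σ ∨ StrictAnti σ) (hc : ∀ (g : G) (x : X), σ (g • x) = g • σ x) (x : X) :
    σ x = x := by
  have hs : ∀ (g : G) (x : X), g • σ x ≠ σ x ↔ g • x ≠ x := fun g x => by
    rw [← hc, σ.injective.ne_iff]
  rcases hσ with hσ | hσ
  · by_contra hx
    rcases lt_or_gt_of_ne hx with hx | hx
    · obtain ⟨f, hf, hm⟩ := h.moving hx
      obtain ⟨z, hz⟩ := h.exists_ne hf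
      exact lt_asymm (hσ (hm z hz).2) (hm _ ((hs f z).2 hz)).1
    · obtain ⟨f, hf, hm⟩ := h.moving hx
      obtain ⟨z, hz⟩ := h.exists_ne hf
      exact lt_asymm (hσ (hm z hz).1) (hm _ ((hs f z).2 hz)).2
  · have : Nonempty X := ⟨x⟩
    obtain ⟨p, q, hp, hq, hpq⟩ := h.exists_before
    obtain ⟨y, hy⟩ := h.exists_ne hp
    obtain ⟨z, hz⟩ := h.exists_ne hq
    exact (lt_asymm (hσ (hpq y z hy hz)) (hpq _ _ ((hs p y).2 hy) ((hs q z).2 hz))).elim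

end

variable {X₁ X₂ G₁ G₂ : Type*} [LinearOrder X₁] [LinearOrder X₂] [Group G₁] [Group G₂]
  [MulAction G₁ X₁] [MulAction G₂ X₂] {α : G₁ ≃* G₂}

theorem matches_symm {x : X₁} {z : X₂} (h : Matches α x z) : Matches α.symm z x := fun g => by
  rw [h, α.apply_symm_apply]

theorem le_iff_of_matches (h₁ : ChainAction X₁ G₁) (h₂ : ChainAction X₂ G₂) {x y : X₁} {z w : X₂}
    (hx : Matches α x z) (hy : Matches α y w) : z ≤ w ↔ x ≤ y := by
  rw [h₁.le_iff_below, h₂.le_iff_below, α.surjective.forall]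
  exact forall_congr' fun f => by rw [hx, hy]

theorem matches_smul (h₁ : ChainAction X₁ G₁) (h₂ : ChainAction X₂ G₂) {x : X₁} {z : X₂}
    (hx : Matches α x z) (g : G₁) : Matches α (g • x) (α g • z) := fun f => by
  rw [h₁.below_smul_iff, h₂.below_smul_iff, hx]
  simp only [map_mul, map_inv]

variable [DenselyOrdered X₁] [DenselyOrdered X₂]

theorem exists_matches [NoMinOrder X₁] [NoMaxOrder X₁]
    (h₁ : ChainAction X₁ G₁) (h₂ : ChainAction X₂ G₂)
    (hc : ∀ S : Set X₂, S.Nonempty → BddAbove S → ∃ x, IsLUB S x)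
    (hα : ∀ f g, Before X₁ f g → Before X₂ (α f) (α g)) (x : X₁) : ∃ z : X₂, Matches α x z := by
  obtain ⟨a, ha⟩ := exists_lt x
  obtain ⟨b, hb⟩ := exists_gt x
  have hbefore : ∀ {f k : G₁}, Below x f → k ≠ 1 → (∀ y : X₁, k • y ≠ y → x < y) →
      Before X₂ (α f) (α k) := fun hf hk hs =>
    hα _ _ ⟨hf.1, hk, fun y z hy hz => (hf.2 y hy).trans_lt (hs z hz)⟩
  -- The set is bounded because a nontrivial element supported above `x` has its image beyond all of
  -- these supports.
  obtain ⟨z, hz⟩ := hc {y : X₂ | ∃ f, Below x f ∧ α f • y ≠ y}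
    (by
      obtain ⟨f, hf, hs⟩ := h₁.moving ha
      obtain ⟨y, hy⟩ := h₂.exists_ne ((EmbeddingLike.map_ne_one_iff (f := α)).2 hf)
      exact ⟨y, f, ⟨hf, fun y hy => (hs y hy).2.le⟩, hy⟩)
    (by
      obtain ⟨k, hk, hs⟩ := h₁.moving hb
      obtain ⟨y, hy⟩ := h₂.exists_ne ((EmbeddingLike.map_ne_one_iff (f := α)).2 hk)
      exact ⟨y, fun w ⟨f, hf, hw⟩ =>
        ((hbefore hf hk fun y hy => (hs y hy).1).2.2 w y hw hy).le⟩)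
  refine ⟨z, fun f => ⟨fun hf => ⟨(EmbeddingLike.map_ne_one_iff (f := α)).2 hf.1, fun y hy =>
    hz.1 ⟨f, hf, hy⟩⟩, fun hf => ⟨(EmbeddingLike.map_ne_one_iff (f := α)).1 hf.1, fun y hy => ?_⟩⟩⟩
  by_contra! hxy
  obtain ⟨c, d, hcy, hyd, hcd⟩ := h₁.exists_Ioo hy
  -- Suppose `f` moves `y > x`. Take `k` supported in `(x, y)` and `l` supported in `(y, d)` inside
  -- the support of `f`. Then the support of `α k` lies above `z` and before that of `α l`, while `α
  -- l` meets `α f`; so `α f` moves a point beyond `z`.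
  obtain ⟨k, hk, hks⟩ := h₁.moving hxy
  obtain ⟨l, hl, hls⟩ := h₁.moving hyd
  obtain ⟨u, hu⟩ := h₁.exists_ne hl
  have hd : ¬ Disj l f := h₁.not_disj_of_ne hu (hcd u (hcy.trans (hls u hu).1) (hls u hu).2)
  rw [← disj_map_iff α] at hd
  obtain ⟨w, hw, hw'⟩ := h₂.not_disj_iff.1 hd
  obtain ⟨v, hv⟩ := h₂.exists_ne ((EmbeddingLike.map_ne_one_iff (f := α)).2 hk)
  have h3 : z ≤ v := hz.2 fun s ⟨e, he, hs⟩ =>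
    ((hbefore he hk fun y hy => (hks y hy).1).2.2 s v hs hv).le
  have h4 : v < w := (hα k l ⟨hk, hl, fun y z hy hz => (hks y hy).2.trans (hls z hz).1⟩).2.2 v w
    hv hw
  exact (hf.2 w hw').not_gt (h3.trans_lt h4)

theorem exists_orderIso [NoMinOrder X₁] [NoMaxOrder X₁] [NoMinOrder X₂] [NoMaxOrder X₂]
    (h₁ : ChainAction X₁ G₁) (h₂ : ChainAction X₂ G₂)
    (hc₁ : ∀ S : Set X₁, S.Nonempty → BddAbove S → ∃ x, IsLUB S x)
    (hc₂ : ∀ S : Set X₂, S.Nonempty → BddAbove S → ∃ x, IsLUB S x)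
    (hα : ∀ f g, Before X₁ f g ↔ Before X₂ (α f) (α g)) :
    ∃ τ : X₁ ≃o X₂, ∀ (g : G₁) (x : X₁), τ (g • x) = α g • τ x := by
  choose τ hτ using h₁.exists_matches h₂ hc₂ fun f g => (hα f g).1
  have hmono : StrictMono τ := fun x y hxy => by
    rw [← not_le, h₁.le_iff_of_matches h₂ (hτ y) (hτ x), not_le]
    exact hxy
  have huniq : ∀ {x : X₁} {z : X₂}, Matches α x z → τ x = z := fun {x z} hx =>
    le_antisymm ((h₁.le_iff_of_matches h₂ (hτ x) hx).2 le_rfl)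
      ((h₁.le_iff_of_matches h₂ hx (hτ x)).2 le_rfl)
  have hsurj : Function.Surjective τ := fun z => by
    obtain ⟨x, hx⟩ := h₂.exists_matches (α := α.symm) h₁ hc₁
      (fun f g hfg => (hα _ _).2 (by simpa using hfg)) z
    exact ⟨x, huniq (matches_symm hx)⟩
  exact ⟨hmono.orderIsoOfSurjective τ hsurj, fun g x => huniq (h₁.matches_smul h₂ (hτ x) g)⟩

theorem exists_monotonic_bijection [Nonempty X₁] [NoMinOrder X₁] [NoMaxOrder X₁] [NoMinOrder X₂]
    [NoMaxOrder X₂] (h₁ : ChainAction X₁ G₁) (h₂ : ChainAction X₂ G₂)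
    (hc₁ : ∀ S : Set X₁, S.Nonempty → BddAbove S → ∃ x, IsLUB S x)
    (hc₂ : ∀ S : Set X₂, S.Nonempty → BddAbove S → ∃ x, IsLUB S x)
    (hc₂' : ∀ S : Set X₂, S.Nonempty → BddBelow S → ∃ x, IsGLB S x) (α : G₁ ≃* G₂) :
    ∃ τ : X₁ ≃ X₂, (StrictMono τ ∨ StrictAnti τ) ∧
      ∀ (g : G₁) (x : X₁), τ (g • x) = α g • τ x := by
  obtain ⟨p, q, hpq⟩ := h₁.exists_before
  rcases h₂.sep_iff.1 ((sep_map_iff α).2 (h₁.sep_of_before hpq)) with hb | hb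
  · obtain ⟨τ, hτ⟩ := h₁.exists_orderIso h₂ (α := α) hc₁ hc₂ fun f g => by
      rw [← h₁.dir_iff_of_before hpq, ← h₂.dir_iff_of_before hb, dir_map_iff]
    exact ⟨τ.toEquiv, .inl τ.strictMono, hτ⟩
  -- Here `α` reverses the compass pair, hence the order of all supports, and the construction is
  -- carried out for the reversed second chain.
  · obtain ⟨τ, hτ⟩ := h₁.exists_orderIso h₂.dual (α := α) hc₁ hc₂' fun f g => by
      rw [← h₁.dir_iff_of_before hpq, ← h₂.dual.dir_iff_of_before hb.dual, dir_map_iff]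
    exact ⟨τ.toEquiv.trans OrderDual.ofDual, .inr fun x y hxy => τ.strictMono hxy, hτ⟩

end ChainAction

/-- The direction of the image of one reference pair `a < b` decides the direction of every other
pair. -/
theorem ed_iff_ed_iff_monotonic {X Y : Type*} [LinearOrder X] [LinearOrder Y] [Nontrivial X]
    (τ : X ≃ Y) : (∀ x₁ x₂ y₁ y₂ : X, Ed (τ x₁) (τ x₂) (τ y₁) (τ y₂) ↔ Ed x₁ x₂ y₁ y₂) ↔
      StrictMono τ ∨ StrictAnti τ := by
  constructor
  · intro h
    obtain ⟨a, b, hab⟩ := exists_pair_lt X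
    rcases lt_or_gt_of_ne (τ.injective.ne hab.ne) with hlt | hlt
    · refine .inl fun x y hxy => ?_
      exact (((h a b x y).2 (.inl ⟨hab, hxy⟩)).resolve_right fun hc => lt_asymm hlt hc.1).2
    · refine .inr fun x y hxy => ?_
      exact (((h a b x y).2 (.inl ⟨hab, hxy⟩)).resolve_left fun hc => lt_asymm hlt hc.1).2
  · rintro (h | h) x₁ x₂ y₁ y₂
    · simp only [Ed, gt_iff_lt, h.lt_iff_lt]
    · simp only [Ed, gt_iff_lt, h.lt_iff_gt]
      exact or_comm

/-- A bijection of chains and an isomorphism of groups which are compatible with the actions and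
with the equal direction relations, as an isomorphism of structures. -/
def actEquiv {X₁ X₂ G₁ G₂ : Type*} [LinearOrder X₁] [LinearOrder X₂] [Group G₁] [Group G₂]
    [MulAction G₁ X₁] [MulAction G₂ X₂] (τ : X₁ ≃ X₂) (α : G₁ ≃* G₂)
    (hτ : ∀ x₁ x₂ y₁ y₂ : X₁, Ed (τ x₁) (τ x₂) (τ y₁) (τ y₂) ↔ Ed x₁ x₂ y₁ y₂)
    (hα : ∀ (g : G₁) (x : X₁), τ (g • x) = α g • τ x) :
    actLang.Equiv (ACT X₁ G₁) (ACT X₂ G₂) where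
  toFun
    | .point x => .point (τ x)
    | .elt g => .elt (α g)
  invFun
    | .point x => .point (τ.symm x)
    | .elt g => .elt (α.symm g)
  left_inv := by rintro (x | g) <;> simp
  right_inv := by rintro (x | g) <;> simp
  map_fun' {n} f v := by
    cases f with
    | mul =>
      change _ = ACT.mul _ _
      simp only [Function.comp_apply]
      change (match ACT.mul (v 0) (v 1) with
        | .point x => ACT.point (τ x)
        | .elt g => .elt (α g)) = _
      rcases v 0 with x | g <;> rcases v 1 with y | k <;> simp [ACT.mul]
    | ap =>
      change _ = ACT.ap _ _
      simp only [Function.comp_apply]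
      change (match ACT.ap (v 0) (v 1) with
        | .point x => ACT.point (τ x)
        | .elt g => .elt (α g)) = _
      rcases v 0 with x | g <;> rcases v 1 with y | k <;> simp [ACT.ap, hα]
  map_rel' {n} r v := by
    have hp : ∀ a : ACT X₁ G₁, ACT.IsPoint (X := X₂) (G := G₂) (match a with
        | .point x => ACT.point (τ x)
        | .elt g => .elt (α g)) ↔ ACT.IsPoint a := by
      rintro (x | g) <;> simp [ACT.IsPoint]
    have hg : ∀ a : ACT X₁ G₁, ACT.IsGroup (X := X₂) (G := G₂) (match a with
        | .point x => ACT.point (τ x)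
        | .elt g => .elt (α g)) ↔ ACT.IsGroup a := by
      rintro (x | g) <;> simp [ACT.IsGroup]
    cases r with
    | ed =>
      change (∃ x₁ x₂ y₁ y₂ : X₂, (match v 0 with
          | .point x => ACT.point (τ x)
          | .elt g => .elt (α g)) = _ ∧ (match v 1 with
          | .point x => ACT.point (τ x)
          | .elt g => .elt (α g)) = _ ∧ (match v 2 with
          | .point x => ACT.point (τ x)
          | .elt g => .elt (α g)) = _ ∧ (match v 3 with
          | .point x => ACT.point (τ x)
          | .elt g => .elt (α g)) = _ ∧ _) ↔ ∃ x₁ x₂ y₁ y₂ : X₁, _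
      rcases v 0 with x | g <;> rcases v 1 with y | k <;> rcases v 2 with z | l <;>
        rcases v 3 with w | m <;> simp [hτ]
    | isPoint => exact hp (v 0)
    | isGroup => exact hg (v 0)
    | mulDom => exact and_congr (hg (v 0)) (hg (v 1))
    | apDom => exact and_congr (hg (v 0)) (hp (v 1))

theorem exists_actEquiv_iff {X₁ X₂ G₁ G₂ : Type*} [LinearOrder X₁] [LinearOrder X₂] [Group G₁]
    [Group G₂] [MulAction G₁ X₁] [MulAction G₂ X₂] (τ : X₁ ≃ X₂) (α : G₁ ≃* G₂) :
    ((∀ x₁ x₂ y₁ y₂ : X₁, Ed (τ x₁) (τ x₂) (τ y₁) (τ y₂) ↔ Ed x₁ x₂ y₁ y₂) ∧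
      ∃ Φ : actLang.Equiv (ACT X₁ G₁) (ACT X₂ G₂),
        (∀ x : X₁, Φ (.point x) = .point (τ x)) ∧ ∀ g : G₁, Φ (.elt g) = .elt (α g)) ↔
    ((∀ x₁ x₂ y₁ y₂ : X₁, Ed (τ x₁) (τ x₂) (τ y₁) (τ y₂) ↔ Ed x₁ x₂ y₁ y₂) ∧
      ∀ (g : G₁) (x : X₁), τ (g • x) = α g • τ x) := by
  refine and_congr_right fun hτ => ⟨fun ⟨Φ, hp, hg⟩ g x => ?_, fun hα =>
    ⟨actEquiv τ α hτ hα, fun _ => rfl, fun _ => rfl⟩⟩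
  have h : Φ (.point (g • x)) = ACT.ap (Φ (.elt g)) (Φ (.point x)) :=
    Φ.map_fun (n := 2) ActFunc.ap ![.elt g, .point x]
  rw [hp, hp, hg] at h
  exact ACT.point.inj h

end LinearPermGroup

/-! ### The reconstruction theorem. -/

theorem mainTheorem1 {L₁ L₂ : Type*}
    [LinearOrder L₁] [DenselyOrdered L₁] [NoMinOrder L₁] [NoMaxOrder L₁] [Nontrivial L₁]
    [LinearOrder L₂] [DenselyOrdered L₂] [NoMinOrder L₂] [NoMaxOrder L₂] [Nontrivial L₂]
    (G₁ : Subgroup (L₁ ≃o L₁)) (G₂ : Subgroup (L₂ ≃o L₂))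
    (htrans₁ : LinearPermGroup.IntervalTransitive 2 G₁)
    (htrans₂ : LinearPermGroup.IntervalTransitive 2 G₂)
    (hbdd₁ : ∃ g ∈ G₁, g ≠ 1 ∧ LinearPermGroup.IsBoundedElement g)
    (hbdd₂ : ∃ g ∈ G₂, g ≠ 1 ∧ LinearPermGroup.IsBoundedElement g) :
    (LinearPermGroup.groupLang.ElementarilyEquivalent G₁ G₂ →
      LinearPermGroup.actLang.ElementarilyEquivalent
        (LinearPermGroup.ACT (LinearPermGroup.Ep G₁) G₁)
        (LinearPermGroup.ACT (LinearPermGroup.Ep G₂) G₂)) ∧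
    ∀ α : G₁ ≃* G₂,
      (∃! τ : DedekindCompletion L₁ ≃ DedekindCompletion L₂,
        (StrictMono τ ∨ StrictAnti τ) ∧
        ∀ g : G₁, (fun y : DedekindCompletion L₂ => α g • y) =
          τ ∘ (fun x : DedekindCompletion L₁ => g • x) ∘ τ.symm) ∧
      (∃! τ : DedekindCompletion L₁ ≃ DedekindCompletion L₂,
        (∀ x₁ x₂ y₁ y₂ : DedekindCompletion L₁,
          LinearPermGroup.Ed (τ x₁) (τ x₂) (τ y₁) (τ y₂) ↔ LinearPermGroup.Ed x₁ x₂ y₁ y₂) ∧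
        ∃ Φ : LinearPermGroup.actLang.Equiv
            (LinearPermGroup.ACT (DedekindCompletion L₁) G₁)
            (LinearPermGroup.ACT (DedekindCompletion L₂) G₂),
          (∀ x : DedekindCompletion L₁, Φ (.point x) = .point (τ x)) ∧
          ∀ g : G₁, Φ (.elt g) = .elt (α g)) := by
  have h₁ := LinearPermGroup.chainAction htrans₁ hbdd₁
  have h₂ := LinearPermGroup.chainAction htrans₂ hbdd₂
  refine ⟨(LinearPermGroup.jointInterp_denote h₁ h₂).elementarilyEquivalent, fun α => ?_⟩
  have hu : ∃! τ : DedekindCompletion L₁ ≃ DedekindCompletion L₂,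
      (StrictMono τ ∨ StrictAnti τ) ∧
        ∀ (g : G₁) (x : DedekindCompletion L₁), τ (g • x) = α g • τ x := by
    obtain ⟨τ, hτ, hα⟩ := h₁.exists_monotonic_bijection h₂ DedekindCompletion.exists_isLUB
      DedekindCompletion.exists_isLUB DedekindCompletion.exists_isGLB α
    refine ⟨τ, ⟨hτ, hα⟩, fun σ ⟨hσ, hσα⟩ => Equiv.ext fun x => ?_⟩
    have hmono : ∀ ρ : DedekindCompletion L₁ ≃ DedekindCompletion L₂, StrictMono ρ →
        StrictMono ρ.symm := fun ρ hρ a b hab => by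
      rwa [← hρ.lt_iff_lt, ρ.apply_symm_apply, ρ.apply_symm_apply]
    have hanti : ∀ ρ : DedekindCompletion L₁ ≃ DedekindCompletion L₂, StrictAnti ρ →
        StrictAnti ρ.symm := fun ρ hρ a b hab => by
      rwa [← hρ.lt_iff_gt, ρ.apply_symm_apply, ρ.apply_symm_apply]
    -- Two solutions differ by a monotonic bijection of the first completion that commutes with the
    -- action.
    have hfix := h₁.eq_self_of_commute (σ.trans τ.symm)
      (by
        rcases hσ with hσ | hσ <;> rcases hτ with hτ | hτ
        · exact .inl ((hmono τ hτ).comp hσ)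
        · exact .inr ((hanti τ hτ).comp_strictMono hσ)
        · exact .inr ((hmono τ hτ).comp_strictAnti hσ)
        · exact .inl ((hanti τ hτ).comp hσ))
      (fun g y => by
        rw [Equiv.trans_apply, Equiv.trans_apply, hσα, Equiv.symm_apply_eq, hα,
          Equiv.apply_symm_apply]) x
    exact (Equiv.symm_apply_eq τ).1 hfix
  constructor
  · refine (existsUnique_congr fun τ => and_congr_right fun _ => forall_congr' fun g => ?_).2 hu
    rw [funext_iff, τ.surjective.forall]
    refine forall_congr' fun x => ?_
    simp only [Function.comp_apply, Equiv.symm_apply_apply]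
    exact eq_comm
  · refine (existsUnique_congr fun τ => ?_).2 hu
    rw [LinearPermGroup.exists_actEquiv_iff, LinearPermGroup.ed_iff_ed_iff_monotonic]
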